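/- **Setting.** Let $d\in\mathbb N$, $\gamma\in(0,1)$, and let $N$ be the largest integer with $\gamma N\le 1$. Let $\mathcal T$ be the set of non-empty (non-planar) rooted trees with nodes decorated by $\{0,\dots,d\}$. For $\tau\in\mathcal T$ let $|\tau|$ be its number of nodes, $|\tau|_0$ its number of nodes decorated by $0$, and $\gamma_\tau:=(1-\gamma)|\tau|_0+\gamma|\tau|$. Let $\mathcal H$ be the real vector space spanned by the forests, with the forest product and the Butcher–Connes–Kreimer coproduct, i.e. the multiplicative map with $\Delta\tau=\mathbf 1\otimes\tau+(B_+^i\otimes\mathrm{id})\Delta(\tau_1\cdots\tau_n)$ for $\tau=B^i_+(\tau_1\cdots\tau_n)$. Let $\mathcal H_N$ be the span of the forests with at most $N$ nodes. Its dual $\mathcal H_N^*$ is an algebra with the convolution product $x\star y=(x\otimes y)\Delta$, whose unit is the counit $\mathbf 1^*$; a tree $\tau$ with $|\tau|\le N$ is viewed as the element of $\mathcal H_N^*$ that is $1$ on $\tau$ and $0$ on all other forests. A *branched $\gamma$-rough path* is a map $X:[0,1]^2\to\mathcal H_N^*$ whose values are characters (unital, and multiplicative for the forest product as long as the product lies in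 $\mathcal H_N$), with $X_{tt}=\mathbf 1^*$, $X_{su}\star X_{ut}=X_{st}$ for all $s,u,t\in[0,1]$, and $|\langle X_{st},\tau\rangle|\lesssim|t-s|^{\gamma_\tau}$ for every tree $\tau$ with $|\tau|\le N$. A *renormalisation map* is a linear map $M:\mathcal H_N\to\mathcal H_N$ with $M\mathbf 1=\mathbf 1$, multiplicative for the forest product as long as the product lies in $\mathcal H_N$, with $(M\otimes M)\Delta=\Delta M$, and such that for every tree $\tau$ with $|\tau|\le N$, $M\tau$ is a linear combination of trees $\sigma$ with $\gamma_\sigma\ge\gamma_\tau$ and $|\sigma|\le|\tau|$. Its adjoint is $M^*:\mathcal H_N^*\to\mathcal H_N^*$, and $M^*X$ is defined by $(M^*X)_{st}:=M^*(X_{st})$. A *Chapoton–Foissy basis* is a finite family $\mathcal B_N=(\tau_1,\dots,\tau_m)$ in $\mathcal H_N^*$, each $\tau_i$ being a linear combination of trees that all have the same number $|\tau_i|\le N$ of nodes and the same number $|\tau_i|_0$ of nodes decorated by $0$, such that every element of $\mathcal H_N^*$ has a unique representation $\sum_R\lambda_R\,\tau_{r_1}\star\cdots\star\tau_{r_k}$,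 the sum being over all multi-indices $R=(r_1,\dots,r_k)$, $k\ge0$, with $\sum_j|\tau_{r_j}|\le N$. Given such a basis, let $T_N(\mathcal B_N)$ be the span of the words $\tau_{r_1}\otimes\cdots\otimes\tau_{r_k}$ with $\sum_j|\tau_{r_j}|\le N$, with the concatenation product in which words of degree larger than $N$ are set to $0$, and let $\Psi:\mathcal H^*_N\to T_N(\mathcal B_N)$ be the linear isomorphism $\tau_{r_1}\star\cdots\star\tau_{r_k}\mapsto\tau_{r_1}\otimes\cdots\otimes\tau_{r_k}$. For a renormalisation map $M$, let $\tilde M^*:T_N(\mathcal B_N)\to T_N(\mathcal B_N)$ be the linear map with $\tilde M^*(\tau_{r_1}\otimes\cdots\otimes\tau_{r_k})=\Psi(M^*\tau_{r_1})\cdots\Psi(M^*\tau_{r_k})$. An *anisotropic rough path over $T_N(\mathcal B_N)$* is a map $Y:[0,1]^2\to T_N(\mathcal B_N)$ such that, $\langle Y_{st},w\rangle$ denoting the coefficient of the word $w$ in $Y_{st}$: $w\mapsto\langle Y_{st},w\rangle$ is a character for the shuffle product (on products of words of total degree at most $N$), $Y_{tt}$ is the empty word, $Y_{su}\,Y_{ut}=Y_{st}$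 for all $s,u,t\in[0,1]$, and $|\langle Y_{st},w\rangle|\lesssim|t-s|^{\gamma_{r_1}+\cdots+\gamma_{r_k}}$ for every word $w=\tau_{r_1}\otimes\cdots\otimes\tau_{r_k}$ with $\sum_j|\tau_{r_j}|\le N$, where $\gamma_i:=(1-\gamma)|\tau_i|_0+\gamma|\tau_i|$. **Theorem 4.6.** A Chapoton–Foissy basis exists. Moreover, for every Chapoton–Foissy basis $\mathcal B_N$ and every renormalisation map $M$, the map $\tilde M^*$ satisfies $\tilde M^*(uv)=(\tilde M^*u)(\tilde M^*v)$ for all $u,v\in T_N(\mathcal B_N)$ and $\tilde M^*\tau_i=\Psi(M^*\tau_i)$ for all $i$; and for every branched $\gamma$-rough path $X$, $M^*X$ is a branched $\gamma$-rough path, $\Psi(X)$ and $\tilde M^*\Psi(X)$ are anisotropic rough paths over $T_N(\mathcal B_N)$, and $$\Psi(M^*X)=\tilde M^*\,\Psi(X).$$ -/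

import Mathlib

open scoped TensorProduct

namespace RoughTrees

/-! ### Decorated rooted trees and forests -/

/-- Planar forests with nodes decorated by `Fin (d + 1)`, that is by `{0, …, d}`:
`cons i f g` is the forest whose first tree has a root decorated by `i` carrying the
forest `f`, and whose remaining trees form `g`. -/
inductive PlanarForest (d : ℕ) : Type
  | nil : PlanarForest d
  | cons (i : Fin (d + 1)) (f g : PlanarForest d) : PlanarForest d

/-- One exchange of two neighbouring trees, performed anywhere in a planar forest. -/
inductive PlanarForest.Swap {d : ℕ} : PlanarForest d → PlanarForest d → Prop
  | swap (i : Fin (d + 1)) (f : PlanarForest d) (j : Fin (d + 1)) (g h : PlanarForest d) :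
      Swap (.cons i f (.cons j g h)) (.cons j g (.cons i f h))
  | above (i : Fin (d + 1)) {f f' : PlanarForest d} (g : PlanarForest d) :
      Swap f f' → Swap (.cons i f g) (.cons i f' g)
  | beside (i : Fin (d + 1)) (f : PlanarForest d) {g g' : PlanarForest d} :
      Swap g g' → Swap (.cons i f g) (.cons i f g')

/-- Forests of (non-planar) rooted trees with nodes decorated by `{0, …, d}`: planar forests
up to the order of the trees in the forest and of the branches at every node. -/
def Forest (d : ℕ) : Type := Quot (PlanarForest.Swap (d := d))

/-- A non-empty decorated rooted tree `B₊^i(F)`: the decoration `i` of its root and the forest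
`F` attached to the root. -/
abbrev DTree (d : ℕ) : Type := Fin (d + 1) × Forest d

namespace Forest

variable {d : ℕ}

/-- The empty forest. -/
def nil : Forest d := Quot.mk _ .nil

/-- Adjoin the tree `B₊^i(F)` to the forest `G`. -/
def cons (i : Fin (d + 1)) (F G : Forest d) : Forest d :=
  Quot.map₂ (PlanarForest.cons i) (fun _ _ _ h => .beside i _ h) (fun _ _ _ h => .above i _ h) F G

theorem cons_swap (i j : Fin (d + 1)) (F G K : Forest d) :
    cons i F (cons j G K) = cons j G (cons i F K) := by
  induction F using Quot.ind
  induction G using Quot.ind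
  induction K using Quot.ind
  exact Quot.sound (.swap _ _ _ _ _)

/-- Recursion on planar forests; `step` receives the root decoration of the first tree, the forest
attached to this root, the value there, and the value at the remaining forest. -/
def planarFold {α : Type} (z : α) (step : Fin (d + 1) → Forest d → α → α → α) :
    PlanarForest d → α
  | .nil => z
  | .cons i f g => step i (Quot.mk _ f) (planarFold z step f) (planarFold z step g)

/-- Recursion on forests. -/
def fold {α : Type} (z : α) (step : Fin (d + 1) → Forest d → α → α → α)
    (hstep : ∀ i F a j G b x, step i F a (step j G b x) = step j G b (step i F a x)) :
    Forest d → α :=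
  Quot.lift (planarFold z step) (by
    intro f g h
    induction h with
    | swap i f j g h => exact hstep _ _ _ _ _ _ _
    | above i g h ih => simp only [planarFold, ih, Quot.sound h]
    | beside i f h ih => simp only [planarFold, ih])

/-- The number of nodes of a forest. -/
def size : Forest d → ℕ :=
  fold 0 (fun _ _ a b => 1 + a + b) (by intros; omega)

/-- The number of nodes of a forest that are decorated by `0`. -/
def zeros : Forest d → ℕ :=
  fold 0 (fun i _ a b => (if i = 0 then 1 else 0) + a + b) (by intros; omega)

instance : LeftCommutative (fun (τ : DTree d) (G : Forest d) => cons τ.1 τ.2 G) :=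
  ⟨fun _ _ _ => cons_swap _ _ _ _ _⟩

/-- The forest `τ₁ ⋯ τₙ` with trees `τ₁, …, τₙ`. -/
def ofMultiset (s : Multiset (DTree d)) : Forest d :=
  s.foldr (fun τ G => cons τ.1 τ.2 G) nil

end Forest

/-- The number `|τ|` of nodes of a tree. -/
def DTree.size {d : ℕ} (τ : DTree d) : ℕ := 1 + Forest.size τ.2

/-- The number `|τ|₀` of nodes of a tree that are decorated by `0`. -/
def DTree.zeros {d : ℕ} (τ : DTree d) : ℕ := (if τ.1 = 0 then 1 else 0) + Forest.zeros τ.2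

/-- The exponent `γ_τ = (1 - γ) |τ|₀ + γ |τ|` attached to `n = |τ|` and `k = |τ|₀`;
it is `γ |τ|` if `0` does not occur in `τ`. -/
def weight (γ : ℝ) (n k : ℕ) : ℝ := (1 - γ) * k + γ * n

noncomputable section

open MvPolynomial

/-! ### The Butcher–Connes–Kreimer Hopf algebra and its truncation -/

/-- The linear span of the forests with the forest product. The monomial with exponent
`m : DTree d →₀ ℕ` is the forest that contains every tree `τ` exactly `m τ` times. -/
abbrev H (d : ℕ) : Type := MvPolynomial (DTree d) ℝ

/-- The operator `B₊^i`, which joins the trees of a forest to a new root decorated by `i`. -/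
def graft {d : ℕ} (i : Fin (d + 1)) : H d →ₗ[ℝ] H d :=
  (basisMonomials (DTree d) ℝ).constr ℝ
    (fun m => X (i, Forest.ofMultiset (Finsupp.toMultiset m)))

/-- The Butcher–Connes–Kreimer coproduct of a forest, by recursion: it is multiplicative, and
`Δ (B₊^i F) = 1 ⊗ B₊^i F + (B₊^i ⊗ id) Δ F`. -/
def forestCoprod {d : ℕ} : Forest d → H d ⊗[ℝ] H d :=
  Forest.fold 1
    (fun i F a b =>
      ((1 : H d) ⊗ₜ[ℝ] (X (i, F) : H d) + TensorProduct.map (graft i) LinearMap.id a) * b)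
    (by intros; ring)

/-- The Butcher–Connes–Kreimer coproduct `Δ`. -/
def coprod (d : ℕ) : H d →ₐ[ℝ] H d ⊗[ℝ] H d :=
  aeval (fun τ : DTree d => (1 : H d) ⊗ₜ[ℝ] (X τ : H d) +
    TensorProduct.map (graft τ.1) LinearMap.id (forestCoprod τ.2))

/-- The number of nodes of the forest given by an exponent. -/
def monoSize {d : ℕ} (m : DTree d →₀ ℕ) : ℕ := m.sum fun τ k => k * τ.size

/-- The span `H_N` of the forests with at most `N` nodes. -/
def HN (d N : ℕ) : Submodule ℝ (H d) := restrictSupport ℝ {m | monoSize m ≤ N}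

theorem monomial_mem_HN {d N : ℕ} {m : DTree d →₀ ℕ} (h : monoSize m ≤ N) :
    (monomial m 1 : H d) ∈ HN d N :=
  (monomial_mem_restrictSupport ℝ).2 (Or.inl h)

theorem one_mem_HN (d N : ℕ) : (1 : H d) ∈ HN d N :=
  monomial_mem_HN (m := 0) (by simp [monoSize])

theorem tree_mem_HN {d N : ℕ} {τ : DTree d} (h : τ.size ≤ N) : (X τ : H d) ∈ HN d N :=
  monomial_mem_HN (m := Finsupp.single τ 1) (by simpa [monoSize] using h)

/-- The projection of `H` onto `H_N` that annihilates the forests with more than `N` nodes. -/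
def trunc (d N : ℕ) : H d →ₗ[ℝ] HN d N :=
  (basisMonomials (DTree d) ℝ).constr ℝ
    (fun m => if h : monoSize m ≤ N then ⟨monomial m 1, monomial_mem_HN h⟩ else 0)

/-- The coproduct of `H_N`, the restriction of `Δ`. Since `Δ` preserves the total number of
nodes, it maps `H_N` into `H_N ⊗ H_N`, and the projections do not remove anything. -/
def coprodN (d N : ℕ) : HN d N →ₗ[ℝ] HN d N ⊗[ℝ] HN d N :=
  TensorProduct.map (trunc d N) (trunc d N) ∘ₗ (coprod d).toLinearMap ∘ₗ (HN d N).subtype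

/-- The dual space `H_N^*`. -/
abbrev Dual (d N : ℕ) : Type := Module.Dual ℝ (HN d N)

/-- The convolution product `x ⋆ y = (x ⊗ y) Δ` on `H_N^*`. -/
def conv {d N : ℕ} (x y : Dual d N) : Dual d N :=
  LinearMap.mul' ℝ ℝ ∘ₗ TensorProduct.map x y ∘ₗ coprodN d N

/-- The functional dual to a forest, equal to `1` on this forest and to `0` on all others. -/
def forestDual {d : ℕ} (N : ℕ) (m : DTree d →₀ ℕ) : Dual d N :=
  lcoeff ℝ m ∘ₗ (HN d N).subtype

/-- The counit `1^*`, the unit of the convolution product. -/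
def counit (d N : ℕ) : Dual d N := forestDual N 0

/-- A tree `τ`, viewed as an element of `H_N^*`. -/
def treeDual {d : ℕ} (N : ℕ) (τ : DTree d) : Dual d N := forestDual N (Finsupp.single τ 1)

/-- Characters of `H_N`: unital functionals which are multiplicative for the forest product
as long as this product stays in `H_N`. -/
def IsCharacter {d N : ℕ} (x : Dual d N) : Prop :=
  x ⟨1, one_mem_HN d N⟩ = 1 ∧
    ∀ a b c : HN d N, (c : H d) = (a : H d) * (b : H d) → x c = x a * x b

/-- Branched `γ`-rough paths with values in the characters of `H_N`. -/
structure IsBRP {d N : ℕ} (γ : ℝ) (X : unitInterval → unitInterval → Dual d N) : Prop where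
  character : ∀ s t, IsCharacter (X s t)
  diag : ∀ t, X t t = counit d N
  chen : ∀ s u t, conv (X s u) (X u t) = X s t
  bound : ∀ (τ : DTree d) (hτ : τ.size ≤ N), ∃ C : ℝ, ∀ s t : unitInterval,
    |X s t ⟨MvPolynomial.X τ, tree_mem_HN hτ⟩| ≤
      C * |(t : ℝ) - (s : ℝ)| ^ weight γ τ.size τ.zeros

/-! ### Renormalisation maps -/

/-- Renormalisation maps `M : H_N → H_N`: unital and multiplicative for the forest product,
compatible with the coproduct, `(M ⊗ M) Δ = Δ M`, and sending a tree `τ` to a linear combination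
of trees `σ` with `γ_σ ≥ γ_τ` and `|σ| ≤ |τ|`. -/
structure IsRenormalisation {d N : ℕ} (γ : ℝ) (M : HN d N →ₗ[ℝ] HN d N) : Prop where
  map_one : M ⟨1, one_mem_HN d N⟩ = ⟨1, one_mem_HN d N⟩
  map_mul : ∀ a b c : HN d N, (c : H d) = (a : H d) * (b : H d) →
    (M c : H d) = (M a : H d) * (M b : H d)
  cointeraction : TensorProduct.map M M ∘ₗ coprodN d N = coprodN d N ∘ₗ M
  tree : ∀ (τ : DTree d) (hτ : τ.size ≤ N),
    (M ⟨MvPolynomial.X τ, tree_mem_HN hτ⟩ : H d) ∈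
      Submodule.span ℝ ((MvPolynomial.X : DTree d → H d) ''
        {σ | weight γ τ.size τ.zeros ≤ weight γ σ.size σ.zeros ∧ σ.size ≤ τ.size})

/-- The adjoint `M^*` of `M`, so that `⟨M^* x, h⟩ = ⟨x, M h⟩`. -/
def adjoint {d N : ℕ} (M : HN d N →ₗ[ℝ] HN d N) : Dual d N →ₗ[ℝ] Dual d N := M.dualMap

/-! ### The isomorphism with the truncated tensor algebra -/

/-- The total degree of a word, `deg` being the degree of the letters. -/
def wordDeg {n : ℕ} (deg : Fin n → ℕ) (w : List (Fin n)) : ℕ := (w.map deg).sum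

/-- A basis `τ₁, …, τₙ` of a subspace `B_N` of the span of the trees such that every element of
`H_N^*` is in a unique way a linear combination of the products `τ_{r₁} ⋆ ⋯ ⋆ τ_{rₖ}` with
`|τ_{r₁}| + ⋯ + |τ_{rₖ}| ≤ N`. Every letter `τᵢ` is a linear combination of trees with the same
number `|τᵢ| ≤ N` of nodes and the same number `|τᵢ|₀` of nodes decorated by `0`. -/
structure TreeAlphabet (d N : ℕ) where
  /-- The number of letters. -/
  card : ℕ
  /-- The letters `τᵢ`. -/
  letter : Fin card → Dual d N
  /-- The numbers `|τᵢ|`. -/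
  deg : Fin card → ℕ
  /-- The numbers `|τᵢ|₀`. -/
  zeros : Fin card → ℕ
  deg_le : ∀ i, deg i ≤ N
  letter_mem : ∀ i, letter i ∈
    Submodule.span ℝ (treeDual N '' {τ : DTree d | τ.size = deg i ∧ τ.zeros = zeros i})
  linearIndependent : LinearIndependent ℝ
    (fun w : {w : List (Fin card) // wordDeg deg w ≤ N} =>
      (w : List (Fin card)).foldr (fun i x => conv (letter i) x) (counit d N))
  span : ⊤ ≤ Submodule.span ℝ (Set.range
    (fun w : {w : List (Fin card) // wordDeg deg w ≤ N} =>
      (w : List (Fin card)).foldr (fun i x => conv (letter i) x) (counit d N)))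

namespace TreeAlphabet

variable {d N : ℕ}

/-- Words of total degree at most `N`. -/
abbrev Word (B : TreeAlphabet d N) : Type :=
  {w : List (Fin B.card) // wordDeg B.deg w ≤ N}

/-- The truncated tensor algebra `T_N(B_N)`, the span of the words of total degree at most `N`.
Through the basis of words it is identified with its dual: an element is also the functional
that takes on a word the value of the corresponding coefficient. -/
abbrev T (B : TreeAlphabet d N) : Type := B.Word →₀ ℝ

/-- The product of `T_N(B_N)`: concatenation of words, where words of degree larger than `N` are
set to zero. On coefficients it is the convolution product dual to deconcatenation. -/
def concat (B : TreeAlphabet d N) (u v : B.T) : B.T :=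
  u.sum fun w a => v.sum fun w' b =>
    if h : wordDeg B.deg (w.1 ++ w'.1) ≤ N then Finsupp.single ⟨w.1 ++ w'.1, h⟩ (a * b) else 0

/-- The empty word `ε`. -/
def empty (B : TreeAlphabet d N) : B.T :=
  Finsupp.single ⟨[], Nat.zero_le N⟩ 1

/-- A letter as an element of `T_N(B_N)`. -/
def single (B : TreeAlphabet d N) (i : Fin B.card) : B.T :=
  Finsupp.single ⟨[i], by simpa [wordDeg] using B.deg_le i⟩ 1

/-- The basis of `H_N^*` formed by the products `τ_{r₁} ⋆ ⋯ ⋆ τ_{rₖ}`. -/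
def basis (B : TreeAlphabet d N) : Module.Basis B.Word ℝ (Dual d N) :=
  Module.Basis.mk B.linearIndependent B.span

/-- The isomorphism `Ψ : H_N^* → T_N(B_N)`,
`τ_{r₁} ⋆ ⋯ ⋆ τ_{rₖ} ↦ τ_{r₁} ⊗ ⋯ ⊗ τ_{rₖ}`. -/
def Psi (B : TreeAlphabet d N) : Dual d N ≃ₗ[ℝ] B.T := B.basis.repr

/-- The map `M̃^*` on `T_N(B_N)`: it is linear, and it sends a word `τ_{r₁} ⊗ ⋯ ⊗ τ_{rₖ}` to the
product of the elements `Ψ (M^* τ_{rᵢ})`. -/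
def tilde (B : TreeAlphabet d N) (M : HN d N →ₗ[ℝ] HN d N) : B.T →ₗ[ℝ] B.T :=
  Finsupp.linearCombination ℝ (fun w : B.Word =>
    w.1.foldr (fun i x => B.concat (B.Psi (adjoint M (B.letter i))) x) B.empty)

end TreeAlphabet

/-! ### Anisotropic rough paths -/

/-- The shuffles of two words, listed with multiplicity:
`ε ⧢ v = v ⧢ ε = v` and `a u ⧢ b v = a (u ⧢ b v) + b (a u ⧢ v)`. -/
def shuffle {α : Type} : List α → List α → List (List α)
  | [], v => [v]
  | u, [] => [u]
  | a :: u, b :: v =>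
    (shuffle u (b :: v)).map (List.cons a) ++ (shuffle (a :: u) v).map (List.cons b)
  termination_by u v => u.length + v.length

namespace TreeAlphabet

variable {d N : ℕ}

/-- The coefficient of a word in an element of `T_N(B_N)`; it is zero if the degree of the word
exceeds `N`. -/
def coeff (B : TreeAlphabet d N) (y : B.T) (w : List (Fin B.card)) : ℝ :=
  if h : wordDeg B.deg w ≤ N then y ⟨w, h⟩ else 0

/-- Characters of `T_N(B_N)` for the shuffle product. -/
def IsShuffleCharacter (B : TreeAlphabet d N) (y : B.T) : Prop :=
  B.coeff y [] = 1 ∧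
    ∀ u v : List (Fin B.card), wordDeg B.deg u + wordDeg B.deg v ≤ N →
      ((shuffle u v).map (B.coeff y)).sum = B.coeff y u * B.coeff y v

/-- Anisotropic rough paths over `T_N(B_N)` with the exponents `γ_τ` attached to the letters. -/
structure IsARP (B : TreeAlphabet d N) (γ : ℝ) (Y : unitInterval → unitInterval → B.T) : Prop where
  character : ∀ s t, B.IsShuffleCharacter (Y s t)
  diag : ∀ t, Y t t = B.empty
  chen : ∀ s u t, B.concat (Y s u) (Y u t) = Y s t
  bound : ∀ w : List (Fin B.card), wordDeg B.deg w ≤ N → ∃ C : ℝ, ∀ s t : unitInterval,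
    |B.coeff (Y s t) w| ≤
      C * |(t : ℝ) - (s : ℝ)| ^ (w.map fun i => weight γ (B.deg i) (B.zeros i)).sum

end TreeAlphabet

end

end RoughTrees

/-!
Under `Ψ`, the convolution algebra `H_N^*` becomes the truncated tensor algebra over the letters,
and everything except the existence of the letters follows from three facts about `Ψ`.

* `Ψ` is multiplicative (`TreeAlphabet.Psi_conv`). A renormalisation map has a multiplicative and
  unital adjoint, so that `M̃^* = Ψ M^* Ψ⁻¹` (`IsRenormalisation.tilde_eq`).
* The letters are primitive functionals, hence the dual basis of the basis of words multiplies by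
  shuffling (`TreeAlphabet.dualElement_mul`). The coefficient of a word in `Ψ x` is the value of `x`
  at an element of the dual basis, and so characters become shuffle characters.
* The dual basis is homogeneous for the number of nodes and for the number of nodes decorated by
  `0` (`TreeAlphabet.dualElement_homogeneous`). This transports the analytic bounds.

For the existence of the letters one needs that the convolution algebra is freely generated by
linear combinations of trees. The letters constructed here are trees which, in every degree,
represent a basis of the indecomposable functionals spanned by trees.

They generate because trees do: by duality this says that a primitive element `p` of `H` without
tree terms vanishes (`IsPrimitive.eq_zero`). Indeed the derivations `(τ ⊗ id) Δ` annihilate `p`, and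
they agree with the partial derivatives `∂/∂τ` up to terms which do not lower the number of trees.

They are free because there are enough Fox derivatives. Let `p ◁ x` be the sum over the nodes of `p`
of the forests obtained by grafting `x` onto this node. If `p` is primitive, then `x ↦ p ◁ x` is a
cocycle, `Δ (p ◁ x) = 1 ⊗ (p ◁ x) + (p ◁ · ⊗ id) Δ x` (`IsPrimitive.coprod_grow`), and `p ◁ 1` is
`p` times its degree. The transpose `D_p` hence satisfies `D_p (x ⋆ y) = x(1) D_p y + D_p x ⋆ y`. For
primitive elements `p_j` dual to the letters `e_i`, the matrix `D_{p_j} e_i` is triangular with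
respect to the degree, so `∑ e_i ⋆ x_i = 0` forces all `x_i` to vanish
(`linearIndependent_words`).

Both gradings are handled through the bialgebra morphisms `scale`, which multiply a forest `F` by
`a ^ |F| * b ^ |F|₀`.
-/

namespace RoughTrees

noncomputable section

open MvPolynomial

variable {d N : ℕ}

/-! ### Forests and monomials -/

namespace Forest

@[simp] theorem fold_cons {α : Type} (z : α) (step : Fin (d + 1) → Forest d → α → α → α) (h)
    (i : Fin (d + 1)) (F G : Forest d) :
    fold z step h (cons i F G) = step i F (fold z step h F) (fold z step h G) := by
  induction F using Quot.ind
  induction G using Quot.ind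
  rfl

theorem induction {P : Forest d → Prop} (nil : P nil)
    (cons : ∀ i F G, P F → P G → P (cons i F G)) (F : Forest d) : P F := by
  induction F using Quot.ind with
  | mk f =>
    induction f with
    | nil => exact nil
    | cons i f g hf hg => exact cons i _ _ hf hg

@[simp] theorem size_nil : size (nil : Forest d) = 0 := rfl

@[simp] theorem size_cons (i : Fin (d + 1)) (F G : Forest d) :
    size (cons i F G) = 1 + size F + size G := fold_cons ..

@[simp] theorem zeros_nil : zeros (nil : Forest d) = 0 := rfl

@[simp] theorem zeros_cons (i : Fin (d + 1)) (F G : Forest d) :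
    zeros (cons i F G) = (if i = 0 then 1 else 0) + zeros F + zeros G := fold_cons ..

/-- The exponent of the monomial that represents a forest: the multiplicities of its trees. -/
def expo : Forest d → (DTree d →₀ ℕ) :=
  fold 0 (fun i F _ b => Finsupp.single (i, F) 1 + b) (by intros; exact add_left_comm _ _ _)

@[simp] theorem expo_cons (i : Fin (d + 1)) (F G : Forest d) :
    expo (cons i F G) = Finsupp.single (i, F) 1 + expo G := fold_cons ..

@[simp] theorem ofMultiset_cons (τ : DTree d) (s : Multiset (DTree d)) :
    ofMultiset (τ ::ₘ s) = cons τ.1 τ.2 (ofMultiset s) := Multiset.foldr_cons ..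

theorem ofMultiset_expo (F : Forest d) : ofMultiset (Finsupp.toMultiset F.expo) = F := by
  induction F using Forest.induction with
  | nil => rfl
  | cons i F G _ hG => simp [hG]

theorem expo_ofMultiset (s : Multiset (DTree d)) : Finsupp.toMultiset (ofMultiset s).expo = s := by
  induction s using Multiset.induction_on with
  | empty => rfl
  | cons τ s ih => simp [ih]

/-- The forest as an element of the Butcher–Connes–Kreimer algebra. -/
def mono (F : Forest d) : H d := monomial F.expo 1

@[simp] theorem mono_nil : mono (nil : Forest d) = 1 := rfl

@[simp] theorem mono_cons (i : Fin (d + 1)) (F G : Forest d) :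
    mono (cons i F G) = X (i, F) * mono G := by
  simp [mono, X, monomial_mul]

end Forest

open Forest

theorem expo_surjective : Function.Surjective (expo (d := d)) := fun m => by
  classical
  exact ⟨ofMultiset (Finsupp.toMultiset m), by
    simpa using congrArg Multiset.toFinsupp (expo_ofMultiset (Finsupp.toMultiset m))⟩

theorem ext_mono {V : Type*} [AddCommMonoid V] [Module ℝ V] {f g : H d →ₗ[ℝ] V}
    (h : ∀ F : Forest d, f F.mono = g F.mono) : f = g := by
  refine (basisMonomials (DTree d) ℝ).ext fun m => ?_
  obtain ⟨F, rfl⟩ := expo_surjective m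
  simpa [mono] using h F

@[simp] theorem graft_mono (i : Fin (d + 1)) (F : Forest d) : graft i F.mono = X (i, F) := by
  have : F.mono = basisMonomials (DTree d) ℝ F.expo := by simp [mono]
  rw [graft, this, Module.Basis.constr_basis, ofMultiset_expo]

/-- Induction on elements of the Butcher–Connes–Kreimer algebra: it is generated from `1` by
linear combinations, products and the operators `B₊^i`. -/
theorem H_induction {P : H d → Prop} (one : P 1) (add : ∀ p q, P p → P q → P (p + q))
    (smul : ∀ (c : ℝ) p, P p → P (c • p)) (mul : ∀ p q, P p → P q → P (p * q))
    (graft : ∀ i p, P p → P (graft i p)) (p : H d) : P p := by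
  have hF : ∀ F : Forest d, P F.mono := fun F => by
    induction F using Forest.induction with
    | nil => exact one
    | cons i F G hF hG =>
      rw [mono_cons, ← graft_mono]
      exact mul _ _ (graft _ _ hF) hG
  induction p using MvPolynomial.induction_on with
  | C a => simpa [MvPolynomial.algebraMap_eq, Algebra.smul_def] using smul a 1 one
  | add p q hp hq => exact add p q hp hq
  | mul_X p τ hp =>
    rw [← graft_mono τ.1 τ.2]
    exact mul _ _ hp (graft _ _ (hF _))

/-! ### Gradings -/

/-- The number of nodes decorated by `0` of the forest given by an exponent. -/
def monoZeros (m : DTree d →₀ ℕ) : ℕ := m.sum fun τ k => k * τ.zeros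

@[simp] theorem monoSize_zero : monoSize (0 : DTree d →₀ ℕ) = 0 := rfl

@[simp] theorem monoZeros_zero : monoZeros (0 : DTree d →₀ ℕ) = 0 := rfl

@[simp] theorem monoSize_single (τ : DTree d) (k : ℕ) :
    monoSize (Finsupp.single τ k) = k * τ.size := by simp [monoSize]

@[simp] theorem monoZeros_single (τ : DTree d) (k : ℕ) :
    monoZeros (Finsupp.single τ k) = k * τ.zeros := by simp [monoZeros]

@[simp] theorem monoSize_add (m m' : DTree d →₀ ℕ) :
    monoSize (m + m') = monoSize m + monoSize m' :=
  Finsupp.sum_add_index' (by simp) (by intros; ring)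

@[simp] theorem monoZeros_add (m m' : DTree d →₀ ℕ) :
    monoZeros (m + m') = monoZeros m + monoZeros m' :=
  Finsupp.sum_add_index' (by simp) (by intros; ring)

@[simp] theorem monoSize_expo (F : Forest d) : monoSize F.expo = F.size := by
  induction F using Forest.induction with
  | nil => rfl
  | cons i F G _ hG => simp [hG, DTree.size]

@[simp] theorem monoZeros_expo (F : Forest d) : monoZeros F.expo = F.zeros := by
  induction F using Forest.induction with
  | nil => rfl
  | cons i F G _ hG => simp [hG, DTree.zeros]

theorem DTree.size_pos (τ : DTree d) : 0 < τ.size := by simp [DTree.size]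

theorem monoSize_eq_zero {m : DTree d →₀ ℕ} : monoSize m = 0 ↔ m = 0 := by
  refine ⟨fun h => ?_, fun h => by simp [h]⟩
  obtain ⟨F, rfl⟩ := expo_surjective m
  induction F using Forest.induction with
  | nil => rfl
  | cons i F G _ hG => simp [DTree.size] at h

theorem finite_monoSize_le (d n : ℕ) : {m : DTree d →₀ ℕ | monoSize m ≤ n}.Finite := by
  have key : ∀ n, {F : Forest d | F.size ≤ n}.Finite := by
    intro n
    induction n with
    | zero =>
      refine (Set.finite_singleton Forest.nil).subset fun F hF => ?_
      induction F using Forest.induction with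
      | nil => rfl
      | cons i F G _ _ => simp at hF
    | succ n ih =>
      refine (((Set.finite_univ (α := Fin (d + 1))).prod (ih.prod ih)).image
        (fun x => Forest.cons x.1 x.2.1 x.2.2) |>.insert Forest.nil).subset fun F hF => ?_
      induction F using Forest.induction with
      | nil => exact Set.mem_insert _ _
      | cons i F G _ _ =>
        refine Set.mem_insert_of_mem _ ⟨(i, F, G), ⟨trivial, ?_, ?_⟩, rfl⟩ <;>
        · simp only [Set.mem_ofPred_eq, size_cons] at hF ⊢
          omega
  refine ((key n).image expo).subset fun m hm => ?_
  obtain ⟨F, rfl⟩ := expo_surjective m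
  exact ⟨F, by simpa using hm, rfl⟩

/-- The rescaling of a forest `F` by the factor `a ^ |F| * b ^ |F|₀`. Its eigenspaces are spans of
forests with prescribed values of `|F|` and `|F|₀`, which turns statements about the two gradings
into identities between algebra morphisms. -/
def scale (d : ℕ) (a b : ℝ) : H d →ₐ[ℝ] H d :=
  aeval (fun τ : DTree d => (a ^ τ.size * b ^ τ.zeros) • (X τ : H d))

@[simp] theorem scale_X (a b : ℝ) (τ : DTree d) :
    scale d a b (X τ) = (a ^ τ.size * b ^ τ.zeros) • (X τ : H d) := aeval_X ..

@[simp] theorem scale_mono (a b : ℝ) (F : Forest d) :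
    scale d a b F.mono = (a ^ F.size * b ^ F.zeros) • F.mono := by
  induction F using Forest.induction with
  | nil => simp
  | cons i F G _ hG =>
    rw [mono_cons, map_mul, hG, scale_X, smul_mul_smul_comm]
    congr 1
    simp only [DTree.size, DTree.zeros, size_cons, zeros_cons]
    ring

theorem scale_monomial (a b : ℝ) (m : DTree d →₀ ℕ) :
    scale d a b (monomial m 1) = (a ^ monoSize m * b ^ monoZeros m) • monomial m 1 := by
  obtain ⟨F, rfl⟩ := expo_surjective m
  rw [monoSize_expo, monoZeros_expo]
  exact scale_mono a b F

theorem coeff_scale (a b : ℝ) (h : H d) (m : DTree d →₀ ℕ) :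
    coeff m (scale d a b h) = a ^ monoSize m * b ^ monoZeros m * coeff m h := by
  classical
  suffices lcoeff ℝ m ∘ₗ (scale d a b).toLinearMap =
      (a ^ monoSize m * b ^ monoZeros m) • lcoeff ℝ m from LinearMap.congr_fun this h
  refine (basisMonomials (DTree d) ℝ).ext fun n => ?_
  simp only [coe_basisMonomials, LinearMap.comp_apply, AlgHom.toLinearMap_apply, scale_monomial]
  simp only [map_smul, LinearMap.smul_apply, lcoeff_apply, coeff_monomial]
  split_ifs with h
  · rw [h]
  · simp

theorem scale_graft (a b : ℝ) (i : Fin (d + 1)) (h : H d) :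
    scale d a b (graft i h) = (a * if i = 0 then b else 1) • graft i (scale d a b h) := by
  suffices (scale d a b).toLinearMap ∘ₗ graft i =
      (a * if i = 0 then b else 1) • graft i ∘ₗ (scale d a b).toLinearMap from
    LinearMap.congr_fun this h
  refine ext_mono fun F => ?_
  simp only [LinearMap.comp_apply, graft_mono, AlgHom.toLinearMap_apply, scale_X,
    LinearMap.smul_apply, scale_mono, map_smul, smul_smul, DTree.size, DTree.zeros]
  congr 1
  split_ifs <;> ring

theorem mem_HN_iff {h : H d} : h ∈ HN d N ↔ ∀ m, coeff m h ≠ 0 → monoSize m ≤ N := by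
  simp [HN, mem_restrictSupport_iff, Set.subset_def]

/-- Two is a number with pairwise different powers, so the rescalings detect degrees. -/
theorem coeff_eq_zero_of_scale_two {h : H d} {n : ℕ} (hh : scale d 2 1 h = (2 : ℝ) ^ n • h)
    {m : DTree d →₀ ℕ} (hm : monoSize m ≠ n) : coeff m h = 0 := by
  have := congrArg (coeff m) hh
  rw [coeff_scale, coeff_smul, smul_eq_mul, one_pow, mul_one] at this
  by_contra h0
  exact hm (Nat.pow_right_injective le_rfl (by exact_mod_cast mul_right_cancel₀ h0 this))

theorem coeff_eq_zero_of_scale_zeros {h : H d} {k : ℕ} (hh : scale d 1 2 h = (2 : ℝ) ^ k • h)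
    {m : DTree d →₀ ℕ} (hm : monoZeros m ≠ k) : coeff m h = 0 := by
  have := congrArg (coeff m) hh
  rw [coeff_scale, coeff_smul, smul_eq_mul, one_pow, one_mul] at this
  by_contra h0
  exact hm (Nat.pow_right_injective le_rfl (by exact_mod_cast mul_right_cancel₀ h0 this))

theorem mem_HN_of_scale_two {h : H d} {n : ℕ} (hh : scale d 2 1 h = (2 : ℝ) ^ n • h)
    (hn : n ≤ N) : h ∈ HN d N :=
  mem_HN_iff.2 fun m hm => by
    by_contra hc
    exact hm (coeff_eq_zero_of_scale_two hh (by omega))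

theorem trunc_monomial (m : DTree d →₀ ℕ) : (trunc d N (monomial m 1) : H d) =
    if monoSize m ≤ N then monomial m 1 else 0 := by
  have : (monomial m 1 : H d) = basisMonomials (DTree d) ℝ m := by simp
  rw [trunc]
  conv_lhs => rw [this, Module.Basis.constr_basis]
  split_ifs <;> simp

theorem coeff_trunc (m : DTree d →₀ ℕ) (h : H d) : coeff m (trunc d N h : H d) =
    if monoSize m ≤ N then coeff m h else 0 := by
  classical
  suffices lcoeff ℝ m ∘ₗ (HN d N).subtype ∘ₗ trunc d N =
      (if monoSize m ≤ N then (1 : ℝ) else 0) • lcoeff ℝ m by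
    have := LinearMap.congr_fun this h
    simp only [LinearMap.comp_apply, LinearMap.smul_apply, lcoeff_apply,
      Submodule.subtype_apply] at this
    rw [this]; split_ifs <;> simp
  refine (basisMonomials (DTree d) ℝ).ext fun n => ?_
  simp only [coe_basisMonomials, LinearMap.comp_apply, Submodule.subtype_apply, trunc_monomial,
    LinearMap.smul_apply, lcoeff_apply]
  by_cases hmn : n = m
  · subst hmn; split_ifs <;> simp
  · split_ifs <;> simp [coeff_monomial, hmn]

theorem trunc_of_mem {h : H d} (hh : h ∈ HN d N) : trunc d N h = ⟨h, hh⟩ := by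
  refine Subtype.ext (MvPolynomial.ext _ _ fun m => ?_)
  rw [coeff_trunc]
  split_ifs with hm
  · rfl
  · by_contra h0
    exact hm (mem_HN_iff.1 hh m (Ne.symm h0))

@[simp] theorem trunc_coe (h : HN d N) : trunc d N h = h := trunc_of_mem h.2

/-! ### The bialgebra structure -/

theorem coprod_mono (F : Forest d) : coprod d F.mono = forestCoprod F := by
  induction F using Forest.induction with
  | nil => exact map_one _
  | cons i F G _ hG =>
    rw [mono_cons, map_mul, hG, coprod, aeval_X]
    exact (fold_cons ..).symm

/-- `B₊^i` is a cocycle for the coproduct. -/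
theorem coprod_graft (i : Fin (d + 1)) (h : H d) : coprod d (graft i h) =
    (1 : H d) ⊗ₜ[ℝ] graft i h + TensorProduct.map (graft i) LinearMap.id (coprod d h) := by
  suffices (coprod d).toLinearMap ∘ₗ graft i = (TensorProduct.mk ℝ (H d) (H d) 1) ∘ₗ graft i +
      TensorProduct.map (graft i) LinearMap.id ∘ₗ (coprod d).toLinearMap from
    LinearMap.congr_fun this h
  refine ext_mono fun F => ?_
  simp only [LinearMap.comp_apply, LinearMap.add_apply, AlgHom.toLinearMap_apply, graft_mono,
    TensorProduct.mk_apply, coprod_mono]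
  rw [coprod, aeval_X]

theorem coassoc_graft_aux (i : Fin (d + 1)) (z : H d ⊗[ℝ] H d) :
    TensorProduct.assoc ℝ (H d) (H d) (H d) (TensorProduct.map (coprod d).toLinearMap
      LinearMap.id (TensorProduct.map (graft i) LinearMap.id z)) =
    (1 : H d) ⊗ₜ[ℝ] TensorProduct.map (graft i) LinearMap.id z +
      TensorProduct.map (graft i) LinearMap.id (TensorProduct.assoc ℝ (H d) (H d) (H d)
        (TensorProduct.map (coprod d).toLinearMap LinearMap.id z)) := by
  induction z with
  | zero => simp
  | add y z hy hz =>
    simp only [map_add, hy, hz, TensorProduct.tmul_add]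
    abel
  | tmul u v =>
    simp only [TensorProduct.map_tmul, AlgHom.toLinearMap_apply, LinearMap.id_coe, id_eq,
      coprod_graft, TensorProduct.add_tmul, map_add, TensorProduct.assoc_tmul]
    congr 1
    generalize coprod d u = w
    induction w with
    | zero => simp
    | add y z hy hz => simp only [map_add, hy, hz, TensorProduct.add_tmul]
    | tmul u' u'' => simp

theorem coprod_coassoc (h : H d) :
    TensorProduct.assoc ℝ (H d) (H d) (H d)
      (TensorProduct.map (coprod d).toLinearMap LinearMap.id (coprod d h)) =
    TensorProduct.map LinearMap.id (coprod d).toLinearMap (coprod d h) := by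
  induction h using H_induction with
  | one =>
    simp only [map_one, Algebra.TensorProduct.one_def, TensorProduct.map_tmul,
      AlgHom.toLinearMap_apply, LinearMap.id_coe, id_eq, TensorProduct.assoc_tmul]
  | add p q hp hq => simp only [map_add, hp, hq]
  | smul c p hp => simp only [map_smul, hp]
  | mul p q hp hq =>
    have e1 : ∀ z, TensorProduct.assoc ℝ (H d) (H d) (H d)
        (TensorProduct.map (coprod d).toLinearMap LinearMap.id z) =
        (Algebra.TensorProduct.assoc ℝ ℝ ℝ (H d) (H d) (H d)).toAlgHom.comp
          (Algebra.TensorProduct.map (coprod d) (AlgHom.id ℝ (H d))) z := fun _ => rfl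
    have e2 : ∀ z, TensorProduct.map LinearMap.id (coprod d).toLinearMap z =
        Algebra.TensorProduct.map (AlgHom.id ℝ (H d)) (coprod d) z := fun _ => rfl
    rw [e1, e2] at *
    rw [map_mul, map_mul, map_mul, hp, hq]
  | graft i p hp =>
    rw [coprod_graft, map_add, map_add, coassoc_graft_aux, hp, map_add]
    simp only [TensorProduct.map_tmul, AlgHom.toLinearMap_apply, LinearMap.id_coe, id_eq,
      coprod_graft, map_one, Algebra.TensorProduct.one_def, TensorProduct.assoc_tmul,
      TensorProduct.tmul_add, TensorProduct.map_map, add_assoc]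
    rfl

/-- The functional `x ⊗ y` on `H ⊗ H`. -/
def pair (x y : Module.Dual ℝ (H d)) : H d ⊗[ℝ] H d →ₗ[ℝ] ℝ :=
  LinearMap.mul' ℝ ℝ ∘ₗ TensorProduct.map x y

@[simp] theorem pair_tmul (x y : Module.Dual ℝ (H d)) (a b : H d) :
    pair x y (a ⊗ₜ b) = x a * y b := by simp [pair]

/-- The convolution product on the full dual space `H^*`, as a bilinear map. -/
def cv : Module.Dual ℝ (H d) →ₗ[ℝ] Module.Dual ℝ (H d) →ₗ[ℝ] Module.Dual ℝ (H d) :=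
  LinearMap.mk₂ ℝ (fun x y => pair x y ∘ₗ (coprod d).toLinearMap)
    (fun _ _ _ => by simp [pair, TensorProduct.map_add_left, LinearMap.comp_add,
      LinearMap.add_comp])
    (fun _ _ _ => by simp [pair, TensorProduct.map_smul_left, LinearMap.comp_smul,
      LinearMap.smul_comp])
    (fun _ _ _ => by simp [pair, TensorProduct.map_add_right, LinearMap.comp_add,
      LinearMap.add_comp])
    (fun _ _ _ => by simp [pair, TensorProduct.map_smul_right, LinearMap.comp_smul,
      LinearMap.smul_comp])

theorem cv_apply (x y : Module.Dual ℝ (H d)) (h : H d) : cv x y h = pair x y (coprod d h) := rfl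

/-- The functional dual to a forest on all of `H`. -/
abbrev fd (m : DTree d →₀ ℕ) : Module.Dual ℝ (H d) := lcoeff ℝ m

/-- The counit of `H`. -/
abbrev eps : Module.Dual ℝ (H d) := fd 0

theorem eps_one : eps (1 : H d) = 1 := by simp

theorem eps_mul (a b : H d) : eps (a * b) = eps a * eps b := by
  simp [← constantCoeff_eq]

theorem eps_X (τ : DTree d) : eps (X τ : H d) = 0 := by simp

theorem eps_graft (i : Fin (d + 1)) (h : H d) : eps (graft i h) = 0 := by
  suffices eps ∘ₗ graft i = 0 from LinearMap.congr_fun this h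
  exact ext_mono fun F => by simp

theorem eps_mono_cons (i : Fin (d + 1)) (F G : Forest d) : eps (cons i F G).mono = 0 := by
  rw [mono_cons, eps_mul, eps_X, zero_mul]

theorem lid_eps_mul (z w : H d ⊗[ℝ] H d) :
    TensorProduct.lid ℝ (H d) (TensorProduct.map eps LinearMap.id (z * w)) =
    TensorProduct.lid ℝ (H d) (TensorProduct.map eps LinearMap.id z) *
    TensorProduct.lid ℝ (H d) (TensorProduct.map eps LinearMap.id w) := by
  induction z with
  | zero => simp
  | add y z hy hz => simp only [add_mul, map_add, hy, hz]
  | tmul a b =>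
    induction w with
    | zero => simp
    | add y z hy hz => simp only [mul_add, map_add, hy, hz]
    | tmul a' b' =>
      simp only [Algebra.TensorProduct.tmul_mul_tmul, TensorProduct.map_tmul, eps_mul,
        TensorProduct.lid_tmul, LinearMap.id_coe, id_eq, smul_mul_smul_comm]

theorem rid_eps_mul (z w : H d ⊗[ℝ] H d) :
    TensorProduct.rid ℝ (H d) (TensorProduct.map LinearMap.id eps (z * w)) =
    TensorProduct.rid ℝ (H d) (TensorProduct.map LinearMap.id eps z) *
    TensorProduct.rid ℝ (H d) (TensorProduct.map LinearMap.id eps w) := by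
  induction z with
  | zero => simp
  | add y z hy hz => simp only [add_mul, map_add, hy, hz]
  | tmul a b =>
    induction w with
    | zero => simp
    | add y z hy hz => simp only [mul_add, map_add, hy, hz]
    | tmul a' b' =>
      simp only [Algebra.TensorProduct.tmul_mul_tmul, TensorProduct.map_tmul, eps_mul,
        TensorProduct.rid_tmul, LinearMap.id_coe, id_eq, smul_mul_smul_comm]

theorem eps_left (h : H d) :
    TensorProduct.lid ℝ (H d) (TensorProduct.map eps LinearMap.id (coprod d h)) = h := by
  induction h using H_induction with
  | one => simp [Algebra.TensorProduct.one_def]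
  | add p q hp hq => simp only [map_add, hp, hq]
  | smul c p hp => simp only [map_smul, hp]
  | mul p q hp hq => rw [map_mul, lid_eps_mul, hp, hq]
  | graft i p hp =>
    have : eps ∘ₗ graft i = (0 : H d →ₗ[ℝ] ℝ) := LinearMap.ext (eps_graft i)
    rw [coprod_graft, map_add, map_add, TensorProduct.map_map, this]
    simp

theorem eps_right (h : H d) :
    TensorProduct.rid ℝ (H d) (TensorProduct.map LinearMap.id eps (coprod d h)) = h := by
  induction h using H_induction with
  | one => simp [Algebra.TensorProduct.one_def]
  | add p q hp hq => simp only [map_add, hp, hq]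
  | smul c p hp => simp only [map_smul, hp]
  | mul p q hp hq => rw [map_mul, rid_eps_mul, hp, hq]
  | graft i p hp =>
    have key : ∀ z : H d ⊗[ℝ] H d, TensorProduct.rid ℝ (H d) (TensorProduct.map LinearMap.id eps
        (TensorProduct.map (graft i) LinearMap.id z)) =
        graft i (TensorProduct.rid ℝ (H d) (TensorProduct.map LinearMap.id eps z)) := by
      intro z
      induction z with
      | zero => simp
      | add y z hy hz => simp only [map_add, hy, hz]
      | tmul a b => simp only [TensorProduct.map_tmul, LinearMap.id_coe, id_eq,
          TensorProduct.rid_tmul, map_smul]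
    rw [coprod_graft, map_add, map_add, key, hp, TensorProduct.map_tmul, eps_graft]
    simp

theorem eps_cv (x : Module.Dual ℝ (H d)) : cv eps x = x := by
  refine LinearMap.ext fun h => ?_
  conv_rhs => rw [← eps_left h]
  rw [cv_apply]
  generalize coprod d h = z
  induction z with
  | zero => simp
  | add y z hy hz => simp only [map_add, hy, hz]
  | tmul a b => rw [pair_tmul, TensorProduct.map_tmul, TensorProduct.lid_tmul, map_smul]; rfl

theorem cv_eps (x : Module.Dual ℝ (H d)) : cv x eps = x := by
  refine LinearMap.ext fun h => ?_
  conv_rhs => rw [← eps_right h]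
  rw [cv_apply]
  generalize coprod d h = z
  induction z with
  | zero => simp
  | add y z hy hz => simp only [map_add, hy, hz]
  | tmul a b =>
    rw [pair_tmul, TensorProduct.map_tmul, TensorProduct.rid_tmul, map_smul, mul_comm]; rfl

theorem cv_assoc (x y z : Module.Dual ℝ (H d)) : cv (cv x y) z = cv x (cv y z) := by
  refine LinearMap.ext fun h => ?_
  let T : H d ⊗[ℝ] (H d ⊗[ℝ] H d) →ₗ[ℝ] ℝ := LinearMap.mul' ℝ ℝ ∘ₗ TensorProduct.map x (pair y z)
  have h1 : ∀ w : H d ⊗[ℝ] H d, pair (cv x y) z w = T (TensorProduct.assoc ℝ (H d) (H d) (H d)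
      (TensorProduct.map (coprod d).toLinearMap LinearMap.id w)) := by
    intro w
    induction w with
    | zero => simp
    | add y z hy hz => simp only [map_add, hy, hz]
    | tmul a b =>
      rw [pair_tmul, cv_apply, TensorProduct.map_tmul, AlgHom.toLinearMap_apply]
      generalize coprod d a = v
      induction v with
      | zero => simp
      | add y z hy hz => simp only [map_add, TensorProduct.add_tmul, add_mul, hy, hz]
      | tmul a' b' => simp [T, mul_assoc]
  have h2 : ∀ w : H d ⊗[ℝ] H d, pair x (cv y z) w =
      T (TensorProduct.map LinearMap.id (coprod d).toLinearMap w) := by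
    intro w
    induction w with
    | zero => simp
    | add y z hy hz => simp only [map_add, hy, hz]
    | tmul a b => simp [T, cv_apply]
  rw [cv_apply, cv_apply, h1, h2, coprod_coassoc]

/-- The functionals `f_a ⊗ f_b` separate the points of `H ⊗ H`. -/
theorem tensor_ext {z w : H d ⊗[ℝ] H d} (h : ∀ a b, pair (fd a) (fd b) z = pair (fd a) (fd b) w) :
    z = w := by
  let b := basisMonomials (DTree d) ℝ
  have key : ∀ (v : H d ⊗[ℝ] H d) (m m'), (b.tensorProduct b).repr v (m, m') =
      pair (fd m) (fd m') v := by
    intro v m m'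
    induction v with
    | zero => simp
    | add y z hy hz => simp only [map_add, Finsupp.add_apply, hy, hz]
    | tmul p q =>
      rw [Module.Basis.tensorProduct_repr_tmul_apply, pair_tmul, smul_eq_mul, mul_comm]
      rfl
  refine (b.tensorProduct b).ext_elem fun i => ?_
  rw [key, key, h]

/-! ### Homogeneity of the coproduct -/

theorem coprod_scale (a b : ℝ) (h : H d) : coprod d (scale d a b h) =
    TensorProduct.map (scale d a b).toLinearMap (scale d a b).toLinearMap (coprod d h) := by
  induction h using H_induction with
  | one => simp [Algebra.TensorProduct.one_def]
  | add p q hp hq => simp only [map_add, hp, hq]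
  | smul c p hp => simp only [map_smul, hp]
  | mul p q hp hq =>
    have e : ∀ z, TensorProduct.map (scale d a b).toLinearMap (scale d a b).toLinearMap z =
        Algebra.TensorProduct.map (scale d a b) (scale d a b) z := fun _ => rfl
    rw [e] at *
    simp only [map_mul, hp, hq]
  | graft i p hp =>
    have e : (scale d a b).toLinearMap ∘ₗ graft i =
        (a * if i = 0 then b else 1) • graft i ∘ₗ (scale d a b).toLinearMap :=
      LinearMap.ext (scale_graft a b i)
    rw [scale_graft, map_smul, coprod_graft, coprod_graft, hp, map_add, TensorProduct.map_map,
      TensorProduct.map_map, e, TensorProduct.map_smul_left, TensorProduct.map_tmul,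
      AlgHom.toLinearMap_apply, AlgHom.toLinearMap_apply, scale_graft, map_one,
      TensorProduct.tmul_smul, LinearMap.id_comp, LinearMap.comp_id, smul_add]
    rfl

theorem pair_comp_scale (a b : ℝ) (x y : Module.Dual ℝ (H d)) (z : H d ⊗[ℝ] H d) :
    pair x y (TensorProduct.map (scale d a b).toLinearMap (scale d a b).toLinearMap z) =
    pair (x ∘ₗ (scale d a b).toLinearMap) (y ∘ₗ (scale d a b).toLinearMap) z := by
  rw [pair, LinearMap.comp_apply, TensorProduct.map_map]
  rfl

theorem cv_comp_scale (a b : ℝ) (x y : Module.Dual ℝ (H d)) :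
    cv x y ∘ₗ (scale d a b).toLinearMap =
    cv (x ∘ₗ (scale d a b).toLinearMap) (y ∘ₗ (scale d a b).toLinearMap) := by
  refine LinearMap.ext fun h => ?_
  rw [LinearMap.comp_apply, AlgHom.toLinearMap_apply, cv_apply, coprod_scale, pair_comp_scale]
  rfl

theorem fd_comp_scale (a b : ℝ) (m : DTree d →₀ ℕ) : fd m ∘ₗ (scale d a b).toLinearMap =
    (a ^ monoSize m * b ^ monoZeros m) • fd m :=
  LinearMap.ext fun h => coeff_scale a b h m

theorem cv_fd_eq_zero {a b : DTree d →₀ ℕ} {h : H d} {n : ℕ}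
    (hh : ∀ m, coeff m h ≠ 0 → monoSize m = n) (hab : monoSize a + monoSize b ≠ n) :
    cv (fd a) (fd b) h = 0 := by
  have hs : scale d 2 1 h = (2 : ℝ) ^ n • h := by
    refine MvPolynomial.ext _ _ fun m => ?_
    rw [coeff_scale, coeff_smul, smul_eq_mul, one_pow, mul_one]
    by_cases hm : coeff m h = 0
    · simp [hm]
    · rw [hh m hm]
  have h1 := LinearMap.congr_fun (cv_comp_scale 2 1 (fd a) (fd b)) h
  rw [LinearMap.comp_apply, AlgHom.toLinearMap_apply, hs, fd_comp_scale, fd_comp_scale,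
    map_smul, map_smul, map_smul, LinearMap.smul_apply, LinearMap.smul_apply,
    LinearMap.smul_apply, smul_smul, smul_eq_mul, smul_eq_mul] at h1
  by_contra h0
  have h2 := mul_right_cancel₀ h0 h1
  rw [one_pow, one_pow, mul_one, mul_one, ← pow_add, add_comm (monoSize b)] at h2
  exact hab (Nat.pow_right_injective le_rfl (by dsimp only; exact_mod_cast h2.symm))

theorem cv_fd_eq_zero_of_mem {a b : DTree d →₀ ℕ} {h : H d} (hh : h ∈ HN d N)
    (hab : N < monoSize a + monoSize b) : cv (fd a) (fd b) h = 0 := by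
  classical
  rw [h.as_sum, map_sum]
  refine Finset.sum_eq_zero fun m hm => cv_fd_eq_zero (n := monoSize m) (fun m' hm' => ?_) ?_
  · rw [coeff_monomial] at hm'
    split_ifs at hm' with h0
    · rw [h0]
    · exact absurd rfl hm'
  · have := mem_HN_iff.1 hh m (mem_support_iff.1 hm)
    omega

/-! ### The truncated dual space as a quotient of the full one -/

/-- Restriction of functionals from `H` to `H_N`. -/
def res (N : ℕ) : Module.Dual ℝ (H d) →ₗ[ℝ] Dual d N := (HN d N).subtype.dualMap

/-- Extension of functionals from `H_N` to `H` by zero on the larger forests. -/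
def ext : Dual d N →ₗ[ℝ] Module.Dual ℝ (H d) := (trunc d N).dualMap

@[simp] theorem res_apply (x : Module.Dual ℝ (H d)) (h : HN d N) : res N x h = x h := rfl

theorem ext_apply (x : Dual d N) (h : H d) : ext x h = x (trunc d N h) := rfl

@[simp] theorem res_ext (x : Dual d N) : res N (ext x) = x :=
  LinearMap.ext fun h => by simp [ext]

theorem trunc_tensor_coprod {h : H d} (hh : h ∈ HN d N) :
    TensorProduct.map ((HN d N).subtype ∘ₗ trunc d N) ((HN d N).subtype ∘ₗ trunc d N)
      (coprod d h) = coprod d h := by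
  refine tensor_ext fun a b => ?_
  have key : ∀ c : DTree d →₀ ℕ, fd c ∘ₗ (HN d N).subtype ∘ₗ trunc d N =
      (if monoSize c ≤ N then (1 : ℝ) else 0) • fd c := fun c => LinearMap.ext fun h => by
    simp only [LinearMap.comp_apply, Submodule.subtype_apply, lcoeff_apply, coeff_trunc,
      LinearMap.smul_apply]
    split_ifs <;> simp
  rw [pair, LinearMap.comp_apply, TensorProduct.map_map, key, key, TensorProduct.map_smul_left,
    TensorProduct.map_smul_right, smul_smul, LinearMap.smul_apply, map_smul]
  change _ • cv (fd a) (fd b) h = cv (fd a) (fd b) h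
  by_cases hab : monoSize a + monoSize b ≤ N
  · rw [if_pos (by omega), if_pos (by omega), one_mul, one_smul]
  · rw [cv_fd_eq_zero_of_mem hh (by omega), smul_zero]

theorem res_cv (x y : Module.Dual ℝ (H d)) : res N (cv x y) = conv (res N x) (res N y) := by
  refine LinearMap.ext fun h => ?_
  rw [res_apply, cv_apply, ← trunc_tensor_coprod h.2]
  rw [pair, LinearMap.comp_apply, TensorProduct.map_map, conv, coprodN, LinearMap.comp_apply,
    LinearMap.comp_apply, LinearMap.comp_apply, LinearMap.comp_apply, TensorProduct.map_map]
  rfl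

/-- The convolution product of `H_N^*` as a bilinear map. -/
def convₗ (d N : ℕ) : Dual d N →ₗ[ℝ] Dual d N →ₗ[ℝ] Dual d N :=
  LinearMap.mk₂ ℝ conv
    (fun _ _ _ => by simp [conv, TensorProduct.map_add_left, LinearMap.comp_add,
      LinearMap.add_comp])
    (fun _ _ _ => by simp [conv, TensorProduct.map_smul_left, LinearMap.comp_smul,
      LinearMap.smul_comp])
    (fun _ _ _ => by simp [conv, TensorProduct.map_add_right, LinearMap.comp_add,
      LinearMap.add_comp])
    (fun _ _ _ => by simp [conv, TensorProduct.map_smul_right, LinearMap.comp_smul,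
      LinearMap.smul_comp])

@[simp] theorem convₗ_apply (x y : Dual d N) : convₗ d N x y = conv x y := rfl

/-! ### Growth of a forest along another one -/

/-- The forest `F` together with `Σ_v F ◁_v x`, where `F ◁_v x` arises from `F` by grafting the
forest `x` onto the node `v` of `F`. -/
def growForest (x : H d) : Forest d → H d × H d :=
  fold (1, 0)
    (fun i F a b => (X (i, F) * b.1, (graft i (a.1 * x) + graft i a.2) * b.1 + X (i, F) * b.2))
    (by intros; ext1 <;> dsimp only <;> ring)

theorem growForest_fst (x : H d) (F : Forest d) : (growForest x F).1 = F.mono := by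
  induction F using Forest.induction with
  | nil => rfl
  | cons i F G _ hG => rw [mono_cons, ← hG, growForest, fold_cons]

/-- The derivation `p ↦ Σ_v p ◁_v x`, which grafts `x` onto the nodes of `p`. -/
def growDer (x : H d) : Derivation ℝ (H d) (H d) :=
  mkDerivation ℝ (fun τ : DTree d => graft τ.1 (τ.2.mono * x) + graft τ.1 (growForest x τ.2).2)

theorem growForest_snd (x : H d) (F : Forest d) : (growForest x F).2 = growDer x F.mono := by
  induction F using Forest.induction with
  | nil => exact (Derivation.map_one_eq_zero _).symm
  | cons i F G hF hG =>
    rw [mono_cons, Derivation.leibniz, ← hG, growDer, mkDerivation_X, ← growForest_fst x,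
      growForest, fold_cons]
    simp only [smul_eq_mul, ← growForest_fst x]
    rw [← growForest, add_comm, mul_comm (growForest x G).1]

theorem growDer_graft (x : H d) (i : Fin (d + 1)) (h : H d) :
    growDer x (graft i h) = graft i (h * x) + graft i (growDer x h) := by
  suffices (growDer x).toLinearMap ∘ₗ graft i =
      graft i ∘ₗ LinearMap.mulRight ℝ x + graft i ∘ₗ (growDer x).toLinearMap from
    LinearMap.congr_fun this h
  refine ext_mono fun F => ?_
  simp only [LinearMap.comp_apply, LinearMap.add_apply, graft_mono, Derivation.coeFn_coe,
    LinearMap.mulRight_apply, ← growForest_snd]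
  rw [growDer, mkDerivation_X]

/-- The growth `Σ_v p ◁_v x` as a bilinear map. -/
def grow : H d →ₗ[ℝ] H d →ₗ[ℝ] H d :=
  LinearMap.mk₂ ℝ (fun p x => growDer x p) (fun _ _ _ => map_add _ _ _)
    (fun _ _ _ => Derivation.map_smul _ _ _)
    (fun p x y => by
      induction p using H_induction with
      | one => simp
      | add p q hp hq => rw [map_add, map_add, map_add, hp, hq]; abel
      | smul c p hp => simp only [Derivation.map_smul, hp, smul_add]
      | mul p q hp hq => simp only [Derivation.leibniz, hp, hq, smul_add]; abel
      | graft i p hp => simp only [growDer_graft, hp, mul_add, map_add]; abel)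
    (fun c p x => by
      induction p using H_induction with
      | one => simp
      | add p q hp hq => rw [map_add, map_add, hp, hq, smul_add]
      | smul c' p hp => rw [Derivation.map_smul, Derivation.map_smul, hp, smul_comm]
      | mul p q hp hq => simp only [Derivation.leibniz, hp, hq, smul_add, smul_eq_mul,
          mul_smul_comm]
      | graft i p hp =>
        simp only [growDer_graft, hp, mul_smul_comm, map_smul, smul_add])

theorem grow_one (x : H d) : grow 1 x = 0 := Derivation.map_one_eq_zero (growDer x)

theorem grow_mul (p q x : H d) : grow (p * q) x = grow p x * q + p * grow q x := by
  change growDer x (p * q) = growDer x p * q + p * growDer x q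
  rw [Derivation.leibniz, smul_eq_mul, smul_eq_mul, mul_comm q, add_comm]

theorem grow_graft (i : Fin (d + 1)) (h x : H d) :
    grow (graft i h) x = graft i (h * x) + graft i (grow h x) := growDer_graft x i h

/-- Grafting the empty forest counts the nodes. -/
theorem grow_mono_one (F : Forest d) : grow F.mono 1 = (F.size : ℝ) • F.mono := by
  induction F using Forest.induction with
  | nil => rw [mono_nil, grow_one]; simp
  | cons i F G hF hG =>
    rw [mono_cons, grow_mul, hG, ← graft_mono, grow_graft, hF, mul_one, map_smul, size_cons]
    push_cast
    rw [add_smul, add_smul, one_smul, add_mul, smul_mul_assoc, mul_smul_comm]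

theorem grow_scale (a b : ℝ) (p x : H d) :
    grow (scale d a b p) (scale d a b x) = scale d a b (grow p x) := by
  induction p using H_induction with
  | one => simp [grow_one]
  | add p q hp hq => simp only [map_add, LinearMap.add_apply, hp, hq]
  | smul c p hp => simp only [map_smul, LinearMap.smul_apply, hp]
  | mul p q hp hq => simp only [map_mul, map_add, grow_mul, hp, hq]
  | graft i p hp =>
    rw [scale_graft, map_smul, LinearMap.smul_apply, grow_graft, grow_graft, hp, map_add,
      scale_graft, scale_graft, map_mul (scale d a b), smul_add]

theorem map₂_grow_mul (z w D : H d ⊗[ℝ] H d) :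
    TensorProduct.map₂ grow (LinearMap.mul ℝ (H d)) (z * w) D =
      TensorProduct.map₂ grow (LinearMap.mul ℝ (H d)) z D * w +
      z * TensorProduct.map₂ grow (LinearMap.mul ℝ (H d)) w D := by
  induction z with
  | zero => simp
  | add y z hy hz => simp only [add_mul, map_add, LinearMap.add_apply, hy, hz]; abel
  | tmul p q =>
    induction w with
    | zero => simp
    | add y z hy hz => simp only [mul_add, map_add, LinearMap.add_apply, hy, hz]; abel
    | tmul p' q' =>
      induction D with
      | zero => simp
      | add y z hy hz => simp only [mul_add, add_mul, map_add, hy, hz]; abel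
      | tmul x y =>
        simp only [Algebra.TensorProduct.tmul_mul_tmul, TensorProduct.map₂_apply_tmul, grow_mul,
          TensorProduct.map_tmul, LinearMap.mul_apply', TensorProduct.add_tmul]
        rw [mul_right_comm q q' y, mul_comm q' y, mul_assoc q y q']

theorem map_grow_mul (z w : H d ⊗[ℝ] H d) (x : H d) :
    TensorProduct.map LinearMap.id (grow.flip x) (z * w) =
      TensorProduct.map LinearMap.id (grow.flip x) z * w +
      z * TensorProduct.map LinearMap.id (grow.flip x) w := by
  induction z with
  | zero => simp
  | add y z hy hz => simp only [add_mul, map_add, hy, hz]; abel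
  | tmul p q =>
    induction w with
    | zero => simp
    | add y z hy hz => simp only [mul_add, map_add, hy, hz]; abel
    | tmul p' q' =>
      simp only [Algebra.TensorProduct.tmul_mul_tmul, TensorProduct.map_tmul, grow_mul,
        LinearMap.flip_apply, TensorProduct.tmul_add, LinearMap.id_coe, id_eq]

theorem map₂_grow_graft (i : Fin (d + 1)) (z D : H d ⊗[ℝ] H d) :
    TensorProduct.map₂ grow (LinearMap.mul ℝ (H d))
        (TensorProduct.map (graft i) LinearMap.id z) D =
      TensorProduct.map (graft i) LinearMap.id (z * D) +
      TensorProduct.map (graft i) LinearMap.id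
        (TensorProduct.map₂ grow (LinearMap.mul ℝ (H d)) z D) := by
  induction z with
  | zero => simp
  | add y z hy hz => simp only [add_mul, map_add, LinearMap.add_apply, hy, hz]; abel
  | tmul p q =>
    induction D with
    | zero => simp
    | add y z hy hz => simp only [mul_add, map_add, hy, hz]; abel
    | tmul x y =>
      simp only [Algebra.TensorProduct.tmul_mul_tmul, TensorProduct.map₂_apply_tmul, grow_graft,
        LinearMap.mul_apply', TensorProduct.add_tmul, TensorProduct.map_tmul, LinearMap.id_coe,
        id_eq]

/-- The coproduct of a growth: a cut of `p ◁_v x` cuts `p`, and it also cuts `x` if the node `v`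
stays in the trunk. -/
theorem coprod_grow (p x : H d) : coprod d (grow p x) =
    TensorProduct.map₂ grow (LinearMap.mul ℝ (H d)) (coprod d p) (coprod d x) +
      TensorProduct.map LinearMap.id (grow.flip x) (coprod d p) := by
  have hone : ∀ (h : H d) (D : H d ⊗[ℝ] H d),
      TensorProduct.map₂ grow (LinearMap.mul ℝ (H d)) ((1 : H d) ⊗ₜ h) D = 0 := by
    intro h D
    induction D with
    | zero => simp
    | add y z hy hz => simp only [map_add, hy, hz, add_zero]
    | tmul x y => rw [TensorProduct.map₂_apply_tmul, TensorProduct.map_tmul, grow_one,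
      TensorProduct.zero_tmul]
  induction p using H_induction with
  | one =>
    rw [grow_one, map_zero, map_one, Algebra.TensorProduct.one_def, hone,
      TensorProduct.map_tmul, LinearMap.flip_apply, grow_one, TensorProduct.tmul_zero, add_zero]
  | add p q hp hq => simp only [map_add, LinearMap.add_apply, hp, hq]; abel
  | smul c p hp => simp only [map_smul, LinearMap.smul_apply, hp, smul_add]
  | mul p q hp hq =>
    rw [grow_mul, map_add, map_mul, map_mul, map_mul, hp, hq, map₂_grow_mul, map_grow_mul]
    ring
  | graft i p hp =>
    have hc : ∀ z : H d ⊗[ℝ] H d, TensorProduct.map LinearMap.id (grow.flip x)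
        (TensorProduct.map (graft i) LinearMap.id z) = TensorProduct.map (graft i) LinearMap.id
          (TensorProduct.map LinearMap.id (grow.flip x) z) := fun z => by
      rw [TensorProduct.map_map, TensorProduct.map_map]
      rfl
    rw [grow_graft, map_add, coprod_graft, coprod_graft, hp, coprod_graft, map_add, map_add,
      map_add, LinearMap.add_apply, hone, map₂_grow_graft, hc, TensorProduct.map_tmul,
      LinearMap.flip_apply, grow_graft, TensorProduct.tmul_add, map_mul (coprod d)]
    simp only [LinearMap.id_coe, id_eq]
    abel

/-! ### Primitive elements and derivations of the dual algebra -/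

/-- Primitive elements: those with `Δ p = p ⊗ 1 + 1 ⊗ p`. -/
def IsPrimitive (p : H d) : Prop := coprod d p = p ⊗ₜ[ℝ] (1 : H d) + (1 : H d) ⊗ₜ[ℝ] p

/-- For a primitive element `p`, the growth along `p` is a cocycle like `B₊^i`. -/
theorem IsPrimitive.coprod_grow {p : H d} (hp : IsPrimitive p) (x : H d) :
    coprod d (grow p x) = (1 : H d) ⊗ₜ[ℝ] grow p x +
      TensorProduct.map (grow p) LinearMap.id (coprod d x) := by
  rw [RoughTrees.coprod_grow, hp]
  have h1 : ∀ D : H d ⊗[ℝ] H d, TensorProduct.map₂ grow (LinearMap.mul ℝ (H d))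
      (p ⊗ₜ[ℝ] (1 : H d) + (1 : H d) ⊗ₜ[ℝ] p) D =
      TensorProduct.map (grow p) LinearMap.id D := by
    intro D
    induction D with
    | zero => simp
    | add y z hy hz => exact (LinearMap.map_add _ y z).trans (by rw [hy, hz, ← map_add])
    | tmul x y =>
      simp only [map_add, LinearMap.add_apply, TensorProduct.map₂_apply_tmul, grow_one,
        TensorProduct.zero_tmul, LinearMap.mul_apply', one_mul, TensorProduct.map_tmul,
        LinearMap.id_coe, id_eq, add_zero]
  rw [h1, map_add, TensorProduct.map_tmul, TensorProduct.map_tmul, LinearMap.flip_apply,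
    LinearMap.flip_apply, grow_one, TensorProduct.tmul_zero, zero_add, add_comm]
  rfl

/-- The transpose of the growth along a primitive element `p` is a Fox derivative of the
convolution algebra: a derivation that takes values in the right regular module. -/
theorem IsPrimitive.cv_comp_grow {p : H d} (hp : IsPrimitive p) (x y : Module.Dual ℝ (H d)) :
    cv x y ∘ₗ grow p = x 1 • (y ∘ₗ grow p) + cv (x ∘ₗ grow p) y := by
  refine LinearMap.ext fun h => ?_
  rw [LinearMap.comp_apply, cv_apply, hp.coprod_grow, map_add, pair_tmul, pair,
    LinearMap.comp_apply, TensorProduct.map_map]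
  rfl

/-! ### Primitive elements are determined by their trees -/

theorem fd_single_mul (τ : DTree d) (a b : H d) : fd (Finsupp.single τ 1) (a * b) =
    fd (Finsupp.single τ 1) a * eps b + eps a * fd (Finsupp.single τ 1) b := by
  have key : ∀ p : H d, fd (Finsupp.single τ 1) p = eps (pderiv τ p) := fun p => by
    simp [coeff_pderiv]
  rw [key, key, key, Derivation.leibniz, map_add, smul_eq_mul, smul_eq_mul, eps_mul, eps_mul]
  ring

theorem lid_fd_mul (τ : DTree d) (z w : H d ⊗[ℝ] H d) :
    TensorProduct.lid ℝ (H d) (TensorProduct.map (fd (Finsupp.single τ 1)) LinearMap.id (z * w)) =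
    TensorProduct.lid ℝ (H d) (TensorProduct.map (fd (Finsupp.single τ 1)) LinearMap.id z) *
    TensorProduct.lid ℝ (H d) (TensorProduct.map eps LinearMap.id w) +
    TensorProduct.lid ℝ (H d) (TensorProduct.map eps LinearMap.id z) *
    TensorProduct.lid ℝ (H d) (TensorProduct.map (fd (Finsupp.single τ 1)) LinearMap.id w) := by
  induction z with
  | zero => simp
  | add y z hy hz => simp only [add_mul, map_add, hy, hz]; ring
  | tmul a b =>
    induction w with
    | zero => simp
    | add y z hy hz => simp only [mul_add, map_add, hy, hz]; ring
    | tmul a' b' =>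
      simp only [Algebra.TensorProduct.tmul_mul_tmul, TensorProduct.map_tmul, fd_single_mul,
        TensorProduct.lid_tmul, LinearMap.id_coe, id_eq, smul_mul_smul_comm, add_smul]

/-- The operator `(τ ⊗ id) Δ`, which removes a trunk equal to the tree `τ`. Since `τ` is a
primitive element of the dual bialgebra, it is a derivation. -/
def trunkDer (τ : DTree d) : Derivation ℝ (H d) (H d) :=
  Derivation.mk' ((TensorProduct.lid ℝ (H d)).toLinearMap ∘ₗ
    TensorProduct.map (fd (Finsupp.single τ 1)) LinearMap.id ∘ₗ (coprod d).toLinearMap)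
    (fun a b => by
      simp only [LinearMap.comp_apply, LinearEquiv.coe_coe, AlgHom.toLinearMap_apply, map_mul,
        lid_fd_mul, eps_left, smul_eq_mul]
      ring)

theorem trunkDer_apply (τ : DTree d) (h : H d) : trunkDer τ h =
    TensorProduct.lid ℝ (H d)
      (TensorProduct.map (fd (Finsupp.single τ 1)) LinearMap.id (coprod d h)) := rfl

theorem eps_trunkDer (τ : DTree d) (h : H d) : eps (trunkDer τ h) = fd (Finsupp.single τ 1) h := by
  conv_rhs => rw [← cv_eps (fd (Finsupp.single τ 1)), cv_apply]
  rw [trunkDer_apply]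
  generalize coprod d h = z
  induction z with
  | zero => simp
  | add y z hy hz => simp only [map_add, hy, hz]
  | tmul a b => rw [pair_tmul, TensorProduct.map_tmul, TensorProduct.lid_tmul, map_smul]; rfl

theorem IsPrimitive.trunkDer_eq {p : H d} (hp : IsPrimitive p) (τ : DTree d) :
    trunkDer τ p = fd (Finsupp.single τ 1) p • (1 : H d) := by
  have h1 : fd (Finsupp.single τ 1) (1 : H d) = 0 := by
    classical
    rw [lcoeff_apply, coeff_one, if_neg (Finsupp.single_ne_zero.2 one_ne_zero).symm]
  rw [trunkDer_apply, hp, map_add, map_add, TensorProduct.map_tmul, TensorProduct.map_tmul,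
    TensorProduct.lid_tmul, TensorProduct.lid_tmul, h1, zero_smul, add_zero]
  rfl

theorem mem_idealOfVars_iff {p : H d} : p ∈ idealOfVars (DTree d) ℝ ↔ eps p = 0 := by
  have := mem_pow_idealOfVars_iff' 1 p
  rw [pow_one] at this
  rw [this]
  refine ⟨fun h => h 0 (by simp), fun h m hm => ?_⟩
  rw [Nat.lt_one_iff, Finsupp.degree_eq_zero_iff] at hm
  rw [hm]
  exact h

theorem derivation_mem_pow_idealOfVars (D : Derivation ℝ (H d) (H d))
    (hD : ∀ τ, D (X τ) ∈ idealOfVars (DTree d) ℝ) (k : ℕ) {p : H d}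
    (hp : p ∈ idealOfVars (DTree d) ℝ ^ k) : D p ∈ idealOfVars (DTree d) ℝ ^ k := by
  induction k generalizing p with
  | zero => simp
  | succ k ih =>
    rw [pow_succ'] at hp ⊢
    refine Submodule.mul_induction_on hp (fun a ha b hb => ?_) (fun a b ha hb => ?_)
    · rw [Derivation.leibniz, smul_eq_mul, smul_eq_mul]
      refine add_mem (Ideal.mul_mem_mul ha (ih hb)) (mul_comm b (D a) ▸ Ideal.mul_mem_mul ?_ hb)
      refine Submodule.span_induction (p := fun x _ => D x ∈ idealOfVars (DTree d) ℝ) ?_ (by simp)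
        (fun x y _ _ hx hy => ?_) (fun c x hx hDx => ?_) ha
      · rintro _ ⟨τ, rfl⟩
        exact hD τ
      · rw [map_add]
        exact add_mem hx hy
      · rw [smul_eq_mul, Derivation.leibniz, smul_eq_mul, smul_eq_mul]
        exact add_mem (Ideal.mul_mem_left _ _ hDx) (Ideal.mul_mem_right _ _ hx)
    · rw [map_add]
      exact add_mem ha hb

/-- A primitive element without tree terms vanishes. The derivation `trunkDer τ` agrees with the
partial derivative `∂/∂τ` up to terms that do not lower the number of trees, so that the terms of
the element with the smallest number of trees have vanishing partial derivatives. -/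
theorem IsPrimitive.eq_zero {p : H d} (hp : IsPrimitive p) (h0 : eps p = 0)
    (h : ∀ τ, fd (Finsupp.single τ 1) p = 0) : p = 0 := by
  have key : ∀ k, p ∈ idealOfVars (DTree d) ℝ ^ (k + 1) := by
    intro k
    induction k with
    | zero => simpa [mem_idealOfVars_iff] using h0
    | succ k ih =>
      rw [mem_pow_idealOfVars_iff'] at ih ⊢
      intro m hm
      rcases (Nat.lt_succ_iff.1 hm).lt_or_eq with hm' | hm'
      · exact ih m hm'
      obtain ⟨τ, hτ⟩ : ∃ τ, m τ ≠ 0 := by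
        by_contra! hc
        have : m = 0 := Finsupp.ext hc
        simp [this] at hm'
      obtain ⟨m', rfl⟩ : ∃ m', m = m' + Finsupp.single τ 1 := by
        obtain ⟨c, hc⟩ := exists_add_of_le
          (Finsupp.single_le_iff.2 (Nat.one_le_iff_ne_zero.2 hτ) : Finsupp.single τ 1 ≤ m)
        exact ⟨c, by rw [hc, add_comm]⟩
      have hd : (trunkDer τ - pderiv τ : Derivation ℝ (H d) (H d)) p ∈
          idealOfVars (DTree d) ℝ ^ (k + 1) := by
        refine derivation_mem_pow_idealOfVars _ (fun σ => ?_) _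
          ((mem_pow_idealOfVars_iff' _ _).2 ih)
        rw [mem_idealOfVars_iff, Derivation.sub_apply, map_sub, eps_trunkDer]
        simp [coeff_pderiv]
      rw [mem_pow_idealOfVars_iff'] at hd
      have h1 := hd m' (by
        rw [map_add, Finsupp.degree_single] at hm'
        omega)
      rw [Derivation.sub_apply, hp.trunkDer_eq, h, zero_smul, zero_sub, coeff_neg, neg_eq_zero,
        coeff_pderiv] at h1
      exact (mul_eq_zero.1 h1).resolve_right (by positivity)
  refine MvPolynomial.ext _ _ fun m => ?_
  exact (mem_pow_idealOfVars_iff' _ _).1 (key m.degree) m (Nat.lt_succ_self _)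

/-! ### Decomposable functionals -/

/-- The functionals of degree `n`: those that vanish on the forests with another number of
nodes. -/
def degDual (d n : ℕ) : Submodule ℝ (Module.Dual ℝ (H d)) where
  carrier := {x | ∀ m, monoSize m ≠ n → x (monomial m 1) = 0}
  zero_mem' := fun _ _ => rfl
  add_mem' := fun ha hb m hm => by rw [LinearMap.add_apply, ha m hm, hb m hm, add_zero]
  smul_mem' := fun c x hx m hm => by rw [LinearMap.smul_apply, hx m hm, smul_zero]

theorem fd_mem_degDual (m : DTree d →₀ ℕ) : fd m ∈ degDual d (monoSize m) := fun m' hm' => by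
  classical
  rw [lcoeff_apply, coeff_monomial, if_neg]
  rintro rfl
  exact hm' rfl

theorem cv_fd_mem_degDual (a b : DTree d →₀ ℕ) :
    cv (fd a) (fd b) ∈ degDual d (monoSize a + monoSize b) := fun m hm => by
  classical
  refine cv_fd_eq_zero (n := monoSize m) (fun m' hm' => ?_) hm.symm
  rw [coeff_monomial] at hm'
  split_ifs at hm' with h0
  · rw [h0]
  · exact absurd rfl hm'

/-- The span of the products of two functionals of positive degree, in degree `n`. -/
def decomposable (d n : ℕ) : Submodule ℝ (Module.Dual ℝ (H d)) :=
  Submodule.span ℝ {x | ∃ a b : DTree d →₀ ℕ,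
    a ≠ 0 ∧ b ≠ 0 ∧ monoSize a + monoSize b = n ∧ x = cv (fd a) (fd b)}

/-- The exponents of the forests with `n` nodes. -/
def monosOfSize (d n : ℕ) : Finset (DTree d →₀ ℕ) :=
  ((finite_monoSize_le d n).subset (fun _ h => le_of_eq h : {m | monoSize m = n} ⊆ _)).toFinset

@[simp] theorem mem_monosOfSize {n : ℕ} {m : DTree d →₀ ℕ} :
    m ∈ monosOfSize d n ↔ monoSize m = n := by simp [monosOfSize]

/-- The element of `H` of degree `n` at which the functionals of degree `n` take the values
prescribed by `φ`. -/
def elementOf (φ : Module.Dual ℝ (Module.Dual ℝ (H d))) (n : ℕ) : H d :=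
  ∑ m ∈ monosOfSize d n, φ (fd m) • (monomial m 1 : H d)

variable {φ : Module.Dual ℝ (Module.Dual ℝ (H d))} {n : ℕ}

theorem eq_sum_fd {x : Module.Dual ℝ (H d)} {s : Finset (DTree d →₀ ℕ)}
    (hx : ∀ m ∉ s, x (monomial m 1) = 0) : x = ∑ m ∈ s, x (monomial m 1) • fd m := by
  classical
  refine (basisMonomials (DTree d) ℝ).ext fun m => ?_
  rw [coe_basisMonomials, LinearMap.sum_apply]
  by_cases hm : m ∈ s
  · rw [Finset.sum_eq_single_of_mem m hm]
    · simp
    · intro b _ hb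
      simp [coeff_monomial, hb.symm]
  · rw [hx m hm, Finset.sum_eq_zero]
    intro b hb
    have : m ≠ b := by rintro rfl; exact hm hb
    simp [coeff_monomial, this]

theorem eq_sum_of_mem_degDual {x : Module.Dual ℝ (H d)} (hx : x ∈ degDual d n) :
    x = ∑ m ∈ monosOfSize d n, x (monomial m 1) • fd m :=
  eq_sum_fd fun m hm => hx m (by simpa using hm)

theorem apply_elementOf {x : Module.Dual ℝ (H d)} (hx : x ∈ degDual d n) :
    x (elementOf φ n) = φ x := by
  conv_rhs => rw [eq_sum_of_mem_degDual hx]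
  simp only [elementOf, map_sum, map_smul, smul_eq_mul, mul_comm]

theorem scale_elementOf (φ : Module.Dual ℝ (Module.Dual ℝ (H d))) (n : ℕ) :
    scale d 2 1 (elementOf φ n) = (2 : ℝ) ^ n • elementOf φ n := by
  rw [elementOf, map_sum, Finset.smul_sum]
  refine Finset.sum_congr rfl fun m hm => ?_
  rw [map_smul, scale_monomial, mem_monosOfSize.1 hm, smul_comm, one_pow, mul_one]

theorem coeff_elementOf_ne_zero {m : DTree d →₀ ℕ} (h : coeff m (elementOf φ n) ≠ 0) :
    monoSize m = n := by
  by_contra hm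
  exact h (coeff_eq_zero_of_scale_two (scale_elementOf φ n) hm)

theorem eps_elementOf (hn : n ≠ 0) : eps (elementOf φ n) = 0 := by
  by_contra h
  exact hn (coeff_elementOf_ne_zero h).symm

theorem grow_elementOf_one : grow (elementOf φ n) 1 = (n : ℝ) • elementOf φ n := by
  rw [elementOf, map_sum, LinearMap.sum_apply, Finset.smul_sum]
  refine Finset.sum_congr rfl fun m hm => ?_
  rw [mem_monosOfSize] at hm
  obtain ⟨F, rfl⟩ := expo_surjective m
  rw [map_smul, LinearMap.smul_apply]
  change _ • grow F.mono 1 = _ • _ • F.mono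
  rw [grow_mono_one, smul_comm, ← hm, monoSize_expo]

theorem isPrimitive_elementOf (hn : n ≠ 0) (hφ : ∀ x ∈ decomposable d n, φ x = 0) :
    IsPrimitive (elementOf φ n) := by
  classical
  have h0 := eps_elementOf (φ := φ) hn
  refine tensor_ext fun a b => ?_
  rw [← cv_apply, map_add, pair_tmul, pair_tmul]
  by_cases ha : a = 0
  · subst ha
    rw [eps_cv, h0, eps_one, zero_mul, zero_add, one_mul]
  by_cases hb : b = 0
  · subst hb
    rw [cv_eps, h0, eps_one, mul_zero, add_zero, mul_one]
  have h1 : ∀ c : DTree d →₀ ℕ, c ≠ 0 → fd c (1 : H d) = 0 := fun c hc => by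
    rw [lcoeff_apply, coeff_one, if_neg (Ne.symm hc)]
  rw [h1 a ha, h1 b hb, zero_mul, mul_zero, add_zero]
  by_cases hab : monoSize a + monoSize b = n
  · subst hab
    rw [apply_elementOf (cv_fd_mem_degDual a b)]
    exact hφ _ (Submodule.subset_span ⟨a, b, ha, hb, rfl, rfl⟩)
  · exact cv_fd_eq_zero (fun m hm => coeff_elementOf_ne_zero hm) hab

/-- The convolution algebra is generated by trees. -/
theorem fd_mem_trees_sup_decomposable {m : DTree d →₀ ℕ} (hm : m ≠ 0) :
    fd m ∈ Submodule.span ℝ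
      ((fun τ : DTree d => fd (Finsupp.single τ 1)) '' {τ | τ.size = monoSize m}) ⊔
      decomposable d (monoSize m) := by
  by_contra hc
  obtain ⟨φ, hφ, hφ0⟩ := Submodule.exists_dual_map_eq_bot_of_notMem hc inferInstance
  have hφ' : ∀ x ∈ Submodule.span ℝ
      ((fun τ : DTree d => fd (Finsupp.single τ 1)) '' {τ | τ.size = monoSize m}) ⊔
      decomposable d (monoSize m), φ x = 0 := fun x hx => by
    have := Submodule.mem_map_of_mem (f := φ) hx
    rwa [hφ0, Submodule.mem_bot] at this
  have hn : monoSize m ≠ 0 := fun h => hm (monoSize_eq_zero.1 h)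
  have hp := isPrimitive_elementOf hn fun x hx => hφ' x (Submodule.mem_sup_right hx)
  have h0 := hp.eq_zero (eps_elementOf hn) fun τ => by
    by_cases hτ : τ.size = monoSize m
    · rw [apply_elementOf]
      · exact hφ' _ (Submodule.mem_sup_left (Submodule.subset_span ⟨τ, hτ, rfl⟩))
      · have := fd_mem_degDual (Finsupp.single τ 1)
        rwa [monoSize_single, one_mul, hτ] at this
    · by_contra h
      exact hτ (by simpa using coeff_elementOf_ne_zero h)
  apply hφ
  rw [← apply_elementOf (φ := φ) (fd_mem_degDual m), h0, map_zero]

/-! ### Independence of words -/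

theorem linearCombination_words {A ι : Type*} [AddCommGroup A] [Module ℝ A] [Fintype ι]
    (mul : A →ₗ[ℝ] A →ₗ[ℝ] A) (one : A) (e : ι → A) (c : List ι →₀ ℝ) :
    Finsupp.linearCombination ℝ (fun w : List ι => w.foldr (fun i x => mul (e i) x) one) c =
      c [] • one + ∑ i, mul (e i) (Finsupp.linearCombination ℝ
        (fun w : List ι => w.foldr (fun i x => mul (e i) x) one)
        (c.comapDomain (List.cons i) (List.cons_injective.injOn))) := by
  classical
  set E := fun w : List ι => w.foldr (fun i x => mul (e i) x) one with hE
  let L : (List ι →₀ ℝ) →ₗ[ℝ] A := (LinearMap.toSpanSingleton ℝ A one) ∘ₗ Finsupp.lapply [] +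
    ∑ i, mul (e i) ∘ₗ Finsupp.linearCombination ℝ E ∘ₗ
      Finsupp.lcomapDomain (List.cons i) List.cons_injective
  suffices Finsupp.linearCombination ℝ E = L by
    have := LinearMap.congr_fun this c
    simpa [L, Finsupp.lcomapDomain] using this
  refine Finsupp.lhom_ext' fun w => LinearMap.ext_ring ?_
  have hcons : ∀ (i : ι) (w : List ι) , Finsupp.comapDomain (List.cons i)
      (Finsupp.single w (1 : ℝ)) List.cons_injective.injOn =
      if w.head? = some i then Finsupp.single w.tail 1 else 0 := by
    intro i w
    ext v
    rw [Finsupp.comapDomain_apply, Finsupp.single_apply]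
    cases w with
    | nil => simp
    | cons j w =>
      by_cases hij : j = i
      · subst hij; simp [Finsupp.single_apply]
      · simp [hij]
  cases w with
  | nil => simp [L, Finsupp.lcomapDomain, hcons, E]
  | cons j w =>
    simp only [L, Finsupp.lcomapDomain, LinearMap.add_apply, LinearMap.comp_apply,
      LinearMap.sum_apply, Finsupp.lsingle_apply, Finsupp.linearCombination_single, one_smul,
      Finsupp.lapply_apply, LinearMap.coe_mk, AddHom.coe_mk, hcons, List.head?_cons,
      Option.some.injEq, List.tail_cons, apply_ite (Finsupp.linearCombination ℝ E), map_zero]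
    rw [Finset.sum_eq_single_of_mem j (Finset.mem_univ j) (fun i _ hi => by simp [hi.symm])]
    simp [E]

/-- A criterion for the freeness of an algebra generated by elements `e i`: there are Fox
derivatives `D j` for which the matrix `D j (e i)` is triangular with respect to a degree. -/
theorem linearIndependent_words {A ι : Type*} [AddCommGroup A] [Module ℝ A] [Finite ι]
    (mul : A →ₗ[ℝ] A →ₗ[ℝ] A) (one : A) (e : ι → A) (ε : A →ₗ[ℝ] ℝ) (D : ι → A →ₗ[ℝ] A)
    (deg : ι → ℕ) (hε1 : ε one = 1) (hε : ∀ i x, ε (mul (e i) x) = 0)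
    (hD : ∀ j i x, D j (mul (e i) x) = mul (D j (e i)) x)
    (hDe : ∀ j x, mul (D j (e j)) x = x)
    (hne : ∀ j i, i ≠ j → deg i ≤ deg j → D j (e i) = 0) :
    LinearIndependent ℝ (fun w : List ι => w.foldr (fun i x => mul (e i) x) one) := by
  cases nonempty_fintype ι
  have step : ∀ x : ι → A, ∑ i, mul (e i) (x i) = 0 → ∀ i, x i = 0 := by
    intro x hx
    by_contra! hc
    classical
    -- For a non-zero `x j` of largest degree, `D j` annihilates all other terms of the sum.
    obtain ⟨i₀, hi₀⟩ := hc
    obtain ⟨j, hj, hmax⟩ := Finset.exists_max_image (Finset.univ.filter fun i => x i ≠ 0) deg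
      ⟨i₀, by simpa using hi₀⟩
    have h1 := congrArg (D j) hx
    rw [map_sum, map_zero, Finset.sum_eq_single_of_mem j (Finset.mem_univ j), hD, hDe] at h1
    · exact (Finset.mem_filter.1 hj).2 h1
    · intro i _ hij
      by_cases hi : x i = 0
      · rw [hi, map_zero, map_zero]
      · rw [hD, hne j i hij (hmax i (by simpa using hi)), map_zero, LinearMap.zero_apply]
  have hnil : ∀ c : List ι →₀ ℝ, Finsupp.linearCombination ℝ
      (fun w : List ι => w.foldr (fun i x => mul (e i) x) one) c = 0 → c [] = 0 := by
    intro c hc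
    rw [linearCombination_words] at hc
    have := congrArg ε hc
    rwa [map_add, map_smul, hε1, map_sum, Finset.sum_eq_zero (fun i _ => hε i _), map_zero,
      add_zero, smul_eq_mul, mul_one] at this
  rw [linearIndependent_iff]
  intro c hc
  ext w
  induction w generalizing c with
  | nil => exact hnil c hc
  | cons i w ih =>
    have h0 := hnil c hc
    rw [linearCombination_words, h0, zero_smul, zero_add] at hc
    exact ih _ (step _ hc i)

/-! ### Words of functionals -/

/-- The product `e_{r₁} ⋆ ⋯ ⋆ e_{rₖ}` in the full dual space. -/
def word {ι : Type*} (e : ι → Module.Dual ℝ (H d)) (w : List ι) : Module.Dual ℝ (H d) :=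
  w.foldr (fun i x => cv (e i) x) eps

section word

variable {ι : Type*} (e : ι → Module.Dual ℝ (H d))

theorem word_nil : word e [] = eps := rfl

theorem word_cons (i : ι) (w : List ι) : word e (i :: w) = cv (e i) (word e w) := rfl

theorem word_append (v w : List ι) : word e (v ++ w) = cv (word e v) (word e w) := by
  induction v with
  | nil => rw [word_nil, eps_cv, List.nil_append]
  | cons i v ih => rw [List.cons_append, word_cons, ih, word_cons, cv_assoc]

theorem res_word (w : List ι) : res N (word e w) =
    w.foldr (fun i x => conv (res N (e i)) x) (counit d N) := by
  induction w with
  | nil => rfl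
  | cons i w ih => rw [word_cons, res_cv, ih, List.foldr_cons]

variable {e}

theorem word_comp_scale {deg zer : ι → ℕ} {a b : ℝ}
    (he : ∀ i, e i ∘ₗ (scale d a b).toLinearMap = (a ^ deg i * b ^ zer i) • e i) (w : List ι) :
    word e w ∘ₗ (scale d a b).toLinearMap =
      (a ^ (w.map deg).sum * b ^ (w.map zer).sum) • word e w := by
  induction w with
  | nil =>
    rw [word_nil, fd_comp_scale, monoSize_zero, monoZeros_zero]
    rfl
  | cons i w ih =>
    rw [word_cons, cv_comp_scale, ih, he, map_smul, map_smul, LinearMap.smul_apply, smul_smul,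
      List.map_cons, List.map_cons, List.sum_cons, List.sum_cons]
    congr 1
    ring

end word

theorem mem_degDual_of_comp_scale {x : Module.Dual ℝ (H d)} {n : ℕ}
    (hx : x ∘ₗ (scale d 2 1).toLinearMap = (2 : ℝ) ^ n • x) : x ∈ degDual d n := fun m hm => by
  have h1 := LinearMap.congr_fun hx (monomial m 1)
  rw [LinearMap.comp_apply, AlgHom.toLinearMap_apply, scale_monomial, map_smul, one_pow, mul_one,
    LinearMap.smul_apply, smul_eq_mul, smul_eq_mul] at h1
  by_contra h0
  exact hm (Nat.pow_right_injective le_rfl (by exact_mod_cast mul_right_cancel₀ h0 h1))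

theorem res_eq_zero {x : Module.Dual ℝ (H d)} {n : ℕ} (hx : x ∈ degDual d n) (hn : N < n) :
    res N x = 0 := by
  refine LinearMap.ext fun h => ?_
  rw [res_apply, (h : H d).as_sum, map_sum]
  refine Finset.sum_eq_zero fun m hm => ?_
  have hm' := mem_HN_iff.1 h.2 m (mem_support_iff.1 hm)
  rw [← mul_one (coeff m (h : H d)), ← smul_eq_mul, ← smul_monomial, map_smul,
    hx m (by omega), smul_zero]

/-! ### Existence of a free generating family of trees -/

/-- In the lowest degrees, the growth along an element of degree `n` is seen by a tree only through
the element itself. -/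
theorem fd_comp_grow_elementOf (φ : Module.Dual ℝ (Module.Dual ℝ (H d))) {n : ℕ} (τ : DTree d)
    (hτ : τ.size ≤ n) : fd (Finsupp.single τ 1) ∘ₗ grow (elementOf φ n) =
      (n * fd (Finsupp.single τ 1) (elementOf φ n) : ℝ) • eps := by
  classical
  refine (basisMonomials (DTree d) ℝ).ext fun m => ?_
  rw [coe_basisMonomials]
  by_cases hm : m = 0
  · subst hm
    change fd (Finsupp.single τ 1) (grow (elementOf φ n) 1) =
      (n * fd (Finsupp.single τ 1) (elementOf φ n) : ℝ) * eps 1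
    rw [grow_elementOf_one, map_smul, eps_one, smul_eq_mul, mul_one]
  · have h1 : scale d 2 1 (grow (elementOf φ n) (monomial m 1)) =
        (2 : ℝ) ^ (n + monoSize m) • grow (elementOf φ n) (monomial m 1) := by
      rw [← grow_scale, scale_elementOf, scale_monomial, map_smul, map_smul,
        LinearMap.smul_apply, smul_smul, one_pow, mul_one, pow_add, mul_comm]
    have h2 : monoSize m ≠ 0 := fun h => hm (monoSize_eq_zero.1 h)
    have h3 : coeff (Finsupp.single τ 1) (grow (elementOf φ n) (monomial m 1)) = 0 :=
      coeff_eq_zero_of_scale_two h1 (by rw [monoSize_single]; omega)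
    have h4 : eps (monomial m 1 : H d) = 0 := by rw [lcoeff_apply, coeff_monomial, if_neg hm]
    rw [LinearMap.comp_apply, LinearMap.smul_apply, lcoeff_apply, h3, h4, smul_zero]

/-- A family of vectors that is linearly independent modulo a subspace has dual functionals that
vanish on this subspace. -/
theorem exists_dual_of_linearIndependent {V κ : Type*} [AddCommGroup V] [Module ℝ V]
    (Q : Submodule ℝ V) {v : κ → V} (hv : LinearIndependent ℝ (Q.mkQ ∘ v)) (k : κ) :
    ∃ φ : Module.Dual ℝ V, (∀ x ∈ Q, φ x = 0) ∧ φ (v k) = 1 ∧ ∀ l, l ≠ k → φ (v l) = 0 := by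
  classical
  obtain ⟨ψ, hψ⟩ := LinearMap.exists_extend ((Finsupp.lapply k) ∘ₗ hv.repr :
    Submodule.span ℝ (Set.range (Q.mkQ ∘ v)) →ₗ[ℝ] ℝ)
  have h1 : ∀ l, ψ (Q.mkQ (v l)) = Finsupp.single l (1 : ℝ) k := fun l => by
    have := LinearMap.congr_fun hψ ⟨(Q.mkQ ∘ v) l, Submodule.subset_span ⟨l, rfl⟩⟩
    rw [← hv.repr_eq_single l ⟨(Q.mkQ ∘ v) l, Submodule.subset_span ⟨l, rfl⟩⟩ rfl]
    exact this
  refine ⟨ψ ∘ₗ Q.mkQ, fun x hx => ?_, ?_, fun l hl => ?_⟩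
  · rw [LinearMap.comp_apply, Submodule.mkQ_apply, (Submodule.Quotient.mk_eq_zero Q).2 hx, map_zero]
  · rw [LinearMap.comp_apply, h1, Finsupp.single_eq_same]
  · rw [LinearMap.comp_apply, h1, Finsupp.single_eq_of_ne hl.symm]

/-- In every degree, some trees represent a basis of the indecomposable functionals. -/
theorem exists_trees (d n : ℕ) : ∃ (κ : Type) (a : κ → DTree d), Function.Injective a ∧
    (∀ k, (a k).size = n) ∧
    LinearIndependent ℝ ((decomposable d n).mkQ ∘ fun k => fd (Finsupp.single (a k) 1)) ∧
    ∀ τ : DTree d, τ.size = n → fd (Finsupp.single τ 1) ∈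
      Submodule.span ℝ (Set.range fun k => fd (Finsupp.single (a k) 1)) ⊔ decomposable d n := by
  obtain ⟨κ, a, ha, hspan, hli⟩ := exists_linearIndependent' ℝ
    (fun τ : {τ : DTree d // τ.size = n} =>
      (decomposable d n).mkQ (fd (Finsupp.single τ.1 1)))
  refine ⟨κ, fun k => (a k).1, Subtype.val_injective.comp ha, fun k => (a k).2, hli,
    fun τ hτ => ?_⟩
  have h1 : (decomposable d n).mkQ (fd (Finsupp.single τ 1)) ∈
      Submodule.span ℝ (Set.range ((decomposable d n).mkQ ∘
        fun k => fd (Finsupp.single (a k).1 1))) :=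
    hspan.ge (Submodule.subset_span ⟨⟨τ, hτ⟩, rfl⟩)
  rw [Set.range_comp, ← Submodule.map_span] at h1
  obtain ⟨y, hy, hyτ⟩ := h1
  have h2 : fd (Finsupp.single τ 1) - y ∈ decomposable d n := by
    rw [← Submodule.Quotient.mk_eq_zero, ← Submodule.mkQ_apply, map_sub, hyτ, sub_self]
  rw [← add_sub_cancel y (fd (Finsupp.single τ 1))]
  exact add_mem (Submodule.mem_sup_left hy) (Submodule.mem_sup_right h2)

/-- The transpose of the growth along `p`, normalised by the degree `n` of `p`. -/
def foxDer (p : H d) (n : ℕ) : Module.Dual ℝ (H d) →ₗ[ℝ] Module.Dual ℝ (H d) :=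
  (n : ℝ)⁻¹ • (grow p).dualMap

theorem foxDer_apply (p : H d) (n : ℕ) (x : Module.Dual ℝ (H d)) :
    foxDer p n x = (n : ℝ)⁻¹ • (x ∘ₗ grow p) := rfl

/-- Trees with a dual family of functionals on the indecomposables are free generators: the Fox
derivatives along the primitive elements that represent the functionals separate the trees. -/
theorem linearIndependent_word_trees {ι : Type*} [Finite ι] (T : ι → DTree d)
    (hφ : ∀ j, ∃ φ : Module.Dual ℝ (Module.Dual ℝ (H d)),
      (∀ x ∈ decomposable d (T j).size, φ x = 0) ∧ φ (fd (Finsupp.single (T j) 1)) = 1 ∧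
      ∀ i, i ≠ j → (T i).size = (T j).size → φ (fd (Finsupp.single (T i) 1)) = 0) :
    LinearIndependent ℝ (word fun i => fd (Finsupp.single (T i) 1)) := by
  choose φ hφ0 hφ1 hφne using hφ
  have hpos : ∀ j, (T j).size ≠ 0 := fun j => (DTree.size_pos _).ne'
  have hprim := fun j => isPrimitive_elementOf (hpos j) (hφ0 j)
  have hT1 : ∀ i, fd (Finsupp.single (T i) 1) (1 : H d) = 0 := fun i => by
    classical
    rw [lcoeff_apply, coeff_one, if_neg (Finsupp.single_ne_zero.2 one_ne_zero).symm]
  have hmem : ∀ i j, (T i).size = (T j).size →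
      fd (Finsupp.single (T i) 1) ∈ degDual d (T j).size := fun i j h => by
    have := fd_mem_degDual (Finsupp.single (T i) 1)
    rwa [monoSize_single, one_mul, h] at this
  refine linearIndependent_words cv eps _ (LinearMap.applyₗ (1 : H d))
    (fun j => foxDer (elementOf (φ j) (T j).size) (T j).size)
    (fun j => (T j).size) eps_one (fun i x => ?_) (fun j i x => ?_)
    (fun j x => ?_) (fun j i hij hdeg => ?_)
  · rw [LinearMap.applyₗ_apply_apply, cv_apply, map_one, Algebra.TensorProduct.one_def, pair_tmul,
      hT1, zero_mul]
  · rw [foxDer_apply, foxDer_apply, (hprim j).cv_comp_grow, hT1, zero_smul, zero_add, map_smul,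
      LinearMap.smul_apply]
  · rw [foxDer_apply, fd_comp_grow_elementOf _ _ le_rfl, apply_elementOf (hmem j j rfl), hφ1,
      mul_one, smul_smul, inv_mul_cancel₀ (Nat.cast_ne_zero.2 (hpos j)), one_smul, eps_cv]
  · have h0 : fd (Finsupp.single (T i) 1) (elementOf (φ j) (T j).size) = 0 := by
      by_cases h : (T i).size = (T j).size
      · rw [apply_elementOf (hmem i j h), hφne j i hij h]
      · by_contra h0
        exact h (by simpa using coeff_elementOf_ne_zero h0)
    rw [foxDer_apply, fd_comp_grow_elementOf _ _ hdeg, h0, mul_zero, zero_smul, smul_zero]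

/-- There are finitely many trees with at most `N` nodes which freely generate the convolution
algebra up to degree `N`. -/
theorem exists_free_generators (d N : ℕ) : ∃ (n : ℕ) (T : Fin n → DTree d),
    (∀ i, (T i).size ≤ N) ∧
    LinearIndependent ℝ (word fun i => fd (Finsupp.single (T i) 1)) ∧
    ∀ m : DTree d →₀ ℕ, monoSize m ≤ N →
      fd m ∈ Submodule.span ℝ (Set.range (word fun i => fd (Finsupp.single (T i) 1))) := by
  choose κ a ha hsize hli hspan using exists_trees d
  let I := Σ n : Fin (N + 1), κ n
  let S : I → DTree d := fun i => a i.1 i.2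
  have hS : ∀ i : I, (S i).size = i.1 := fun i => hsize _ _
  have hSinj : Function.Injective S := by
    rintro ⟨n, k⟩ ⟨n', k'⟩ h
    have h1 : n = n' := Fin.ext (by rw [← hS ⟨n, k⟩, h, hS])
    subst h1
    exact congrArg _ (ha _ h)
  have : Finite I := by
    have : Finite {m : DTree d →₀ ℕ | monoSize m ≤ N} := finite_monoSize_le d N
    refine Finite.of_injective (fun i : I => (⟨Finsupp.single (S i) 1, ?_⟩ :
      {m : DTree d →₀ ℕ | monoSize m ≤ N})) fun i j h => ?_
    · change monoSize _ ≤ N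
      rw [monoSize_single, one_mul, hS]
      omega
    · exact hSinj (Finsupp.single_left_injective one_ne_zero (congrArg Subtype.val h))
  obtain ⟨n, ⟨f⟩⟩ := Finite.exists_equiv_fin I
  let T : Fin n → DTree d := fun i => S (f.symm i)
  have hT : ∀ i, (T i).size = (f.symm i).1 := fun i => hS _
  refine ⟨n, T, fun i => by rw [hT]; omega, ?_, ?_⟩
  · refine linearIndependent_word_trees T fun j => ?_
    obtain ⟨φ, h1, h2, h3⟩ := exists_dual_of_linearIndependent _ (hli _) (f.symm j).2
    refine ⟨φ, by rw [hT]; exact h1, h2, fun i hij hdeg => ?_⟩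
    rw [hT, hT] at hdeg
    have hij' : f.symm i ≠ f.symm j := fun h => hij (f.symm.injective h)
    simp only [T, S]
    generalize f.symm i = i' at *
    generalize f.symm j = j' at *
    obtain ⟨n, k⟩ := i'
    obtain ⟨n', k'⟩ := j'
    obtain rfl : n = n' := Fin.ext hdeg
    exact h3 k fun h => hij' (by rw [h])
  · set e : Fin n → Module.Dual ℝ (H d) := fun i => fd (Finsupp.single (T i) 1) with he
    set W := Submodule.span ℝ (Set.range (word e)) with hW
    have hcv : ∀ x ∈ W, ∀ y ∈ W, cv x y ∈ W := by
      intro x hx y hy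
      have := Submodule.apply_mem_map₂ cv hx hy
      rw [hW, Submodule.map₂_span_span] at this
      refine Submodule.span_mono ?_ this
      rintro _ ⟨_, ⟨v, rfl⟩, _, ⟨w, rfl⟩, rfl⟩
      exact ⟨v ++ w, word_append e v w⟩
    intro m hm
    -- Decomposable functionals are products of functionals of smaller degree.
    induction hk : monoSize m using Nat.strong_induction_on generalizing m with
    | _ k ih =>
      subst hk
      by_cases hm0 : m = 0
      · exact Submodule.subset_span ⟨[], by rw [hm0, word_nil]⟩
      have hdec : decomposable d (monoSize m) ≤ W := by
        refine Submodule.span_le.2 ?_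
        rintro _ ⟨p, q, hp, hq, hpq, rfl⟩
        have h1 := Nat.pos_of_ne_zero fun h => hp (monoSize_eq_zero.1 h)
        have h2 := Nat.pos_of_ne_zero fun h => hq (monoSize_eq_zero.1 h)
        exact hcv _ (ih _ (by omega) p (by omega) rfl) _ (ih _ (by omega) q (by omega) rfl)
      refine (sup_le (Submodule.span_le.2 ?_) hdec : _ ≤ W) (fd_mem_trees_sup_decomposable hm0)
      rintro _ ⟨τ, hτ, rfl⟩
      refine (sup_le (Submodule.span_le.2 ?_) hdec : _ ≤ W) (hspan _ τ hτ)
      rintro _ ⟨k, rfl⟩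
      refine Submodule.subset_span ⟨[f ⟨⟨monoSize m, by omega⟩, k⟩], ?_⟩
      rw [word_cons, word_nil, cv_eps]
      change fd (Finsupp.single (S (f.symm (f _))) 1) = _
      rw [f.symm_apply_apply]

theorem nonempty_treeAlphabet (d N : ℕ) : Nonempty (TreeAlphabet d N) := by
  obtain ⟨n, T, hT, hli, hspan⟩ := exists_free_generators d N
  set e : Fin n → Module.Dual ℝ (H d) := fun i => fd (Finsupp.single (T i) 1) with he
  have hres : ∀ w : List (Fin n), res N (word e w) =
      w.foldr (fun i x => conv (treeDual N (T i)) x) (counit d N) := res_word e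
  have hhom : ∀ w, word e w ∈ degDual d (wordDeg (fun i => (T i).size) w) := fun w => by
    refine mem_degDual_of_comp_scale ?_
    rw [word_comp_scale (deg := fun i => (T i).size) (zer := fun i => (T i).zeros), one_pow,
      mul_one]
    · rfl
    · intro i
      rw [he, fd_comp_scale, monoSize_single, monoZeros_single, one_mul, one_mul]
  refine ⟨⟨n, fun i => treeDual N (T i), fun i => (T i).size, fun i => (T i).zeros, hT,
    fun i => Submodule.subset_span ⟨T i, ⟨rfl, rfl⟩, rfl⟩, ?_, ?_⟩⟩
  · simp only [← hres]
    refine (hli.comp (fun w : {w : List (Fin n) // wordDeg (fun i => (T i).size) w ≤ N} => w.1)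
      Subtype.val_injective).map (f := res N) ?_
    rw [Submodule.disjoint_def]
    intro x hx hx0
    have hlarge : ∀ m, N < monoSize m → x (monomial m 1) = 0 := by
      intro m hm
      refine Submodule.span_induction (p := fun x _ => x (monomial m 1) = 0) ?_ rfl
        (fun x y _ _ hx hy => by rw [LinearMap.add_apply, hx, hy, add_zero])
        (fun c x _ hx => by rw [LinearMap.smul_apply, hx, smul_zero]) hx
      rintro _ ⟨w, rfl⟩
      exact hhom w m (by have := w.2; omega)
    refine (basisMonomials (DTree d) ℝ).ext fun m => ?_
    rw [coe_basisMonomials, LinearMap.zero_apply]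
    by_cases hm : monoSize m ≤ N
    · exact LinearMap.congr_fun hx0 ⟨monomial m 1, monomial_mem_HN hm⟩
    · exact hlarge m (by omega)
  · intro x _
    simp only [← hres]
    set W := Submodule.span ℝ (Set.range
      fun w : {w : List (Fin n) // wordDeg (fun i => (T i).size) w ≤ N} => res N (word e w))
    have hword : ∀ w, res N (word e w) ∈ W := fun w => by
      by_cases hw : wordDeg (fun i => (T i).size) w ≤ N
      · exact Submodule.subset_span ⟨⟨w, hw⟩, rfl⟩
      · rw [res_eq_zero (hhom w) (by omega)]
        exact W.zero_mem
    rw [← res_ext x, eq_sum_fd (x := ext x) (s := (finite_monoSize_le d N).toFinset), map_sum]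
    · refine Submodule.sum_mem _ fun m hm => ?_
      rw [map_smul]
      refine W.smul_mem _ ?_
      have h1 := hspan m (by simpa using hm)
      refine Submodule.span_induction (p := fun x _ => res N x ∈ W) ?_ (by simp)
        (fun x y _ _ hx hy => by rw [map_add]; exact add_mem hx hy)
        (fun c x _ hx => by rw [map_smul]; exact W.smul_mem _ hx) h1
      rintro _ ⟨w, rfl⟩
      exact hword w
    · intro m hm
      have hm' : ¬ monoSize m ≤ N := by simpa using hm
      have : trunc d N (monomial m 1) = 0 := Subtype.ext (by rw [trunc_monomial, if_neg hm']; rfl)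
      rw [ext_apply, this, map_zero]

/-! ### Words over an alphabet -/

theorem ext_treeDual {τ : DTree d} (hτ : τ.size ≤ N) :
    ext (treeDual N τ) = fd (Finsupp.single τ 1) := by
  refine LinearMap.ext fun h => ?_
  change coeff _ (trunc d N h : H d) = coeff _ h
  rw [coeff_trunc, if_pos (by simpa using hτ)]

namespace TreeAlphabet

variable (B : TreeAlphabet d N)

/-- The letters as functionals on `H`. -/
def extLetter (i : Fin B.card) : Module.Dual ℝ (H d) := ext (B.letter i)

theorem extLetter_mem (i : Fin B.card) : B.extLetter i ∈ Submodule.span ℝ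
    ((fun τ : DTree d => fd (Finsupp.single τ 1)) ''
      {τ | τ.size = B.deg i ∧ τ.zeros = B.zeros i}) := by
  have h := Submodule.mem_map_of_mem (f := ext) (B.letter_mem i)
  rw [Submodule.map_span, Set.image_image] at h
  refine Submodule.span_mono ?_ h
  rintro _ ⟨τ, hτ, rfl⟩
  exact ⟨τ, hτ, (ext_treeDual (hτ.1.trans_le (B.deg_le i))).symm⟩

theorem extLetter_comp_scale (a b : ℝ) (i : Fin B.card) :
    B.extLetter i ∘ₗ (scale d a b).toLinearMap = (a ^ B.deg i * b ^ B.zeros i) • B.extLetter i := by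
  refine Submodule.span_induction (p := fun x _ => x ∘ₗ (scale d a b).toLinearMap =
    (a ^ B.deg i * b ^ B.zeros i) • x) ?_ (by simp)
    (fun x y _ _ hx hy => by rw [LinearMap.add_comp, hx, hy, smul_add])
    (fun c x _ hx => by rw [LinearMap.smul_comp, hx, smul_comm]) (B.extLetter_mem i)
  rintro _ ⟨τ, ⟨h1, h2⟩, rfl⟩
  dsimp only
  rw [fd_comp_scale, monoSize_single, monoZeros_single, one_mul, one_mul, h1, h2]

theorem extLetter_mul (i : Fin B.card) (a b : H d) :
    B.extLetter i (a * b) = B.extLetter i a * eps b + eps a * B.extLetter i b := by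
  refine Submodule.span_induction (p := fun x _ => x (a * b) = x a * eps b + eps a * x b) ?_
    (by simp) (fun x y _ _ hx hy => ?_) (fun c x _ hx => ?_) (B.extLetter_mem i)
  · rintro _ ⟨τ, -, rfl⟩
    exact fd_single_mul τ a b
  · simp only [LinearMap.add_apply, hx, hy]
    ring
  · simp only [LinearMap.smul_apply, hx, smul_eq_mul]
    ring

/-- The product of the letters of a word in the full dual space. -/
def extWord (w : List (Fin B.card)) : Module.Dual ℝ (H d) := word B.extLetter w

theorem res_extWord (w : List (Fin B.card)) : res N (B.extWord w) =
    w.foldr (fun i x => conv (B.letter i) x) (counit d N) := by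
  simp only [extWord, res_word, extLetter, res_ext]

theorem basis_apply (w : B.Word) : B.basis w = res N (B.extWord w.1) := by
  rw [basis, Module.Basis.mk_apply, res_extWord]

/-- The total number of nodes decorated by `0` in a word. -/
def wordZeros (w : List (Fin B.card)) : ℕ := (w.map B.zeros).sum

theorem extWord_comp_scale (a b : ℝ) (w : List (Fin B.card)) :
    B.extWord w ∘ₗ (scale d a b).toLinearMap =
      (a ^ wordDeg B.deg w * b ^ B.wordZeros w) • B.extWord w :=
  word_comp_scale (B.extLetter_comp_scale a b) w

theorem extWord_mem_degDual (w : List (Fin B.card)) : B.extWord w ∈ degDual d (wordDeg B.deg w) :=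
  mem_degDual_of_comp_scale (by rw [extWord_comp_scale, one_pow, mul_one])

theorem Psi_res_extWord (w : List (Fin B.card)) : B.Psi (res N (B.extWord w)) =
    if h : wordDeg B.deg w ≤ N then Finsupp.single ⟨w, h⟩ 1 else 0 := by
  split_ifs with h
  · rw [← B.basis_apply ⟨w, h⟩]
    exact B.basis.repr_self _
  · rw [res_eq_zero (B.extWord_mem_degDual w) (by omega), map_zero]

theorem Psi_counit : B.Psi (counit d N) = B.empty := by
  have h := B.Psi_res_extWord []
  rwa [dif_pos (show wordDeg B.deg [] ≤ N from Nat.zero_le N)] at h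

theorem Psi_letter (i : Fin B.card) : B.Psi (B.letter i) = B.single i := by
  have h1 : B.extWord [i] = B.extLetter i := cv_eps _
  have h2 := B.Psi_res_extWord [i]
  rwa [h1, extLetter, res_ext, dif_pos (by simpa [wordDeg] using B.deg_le i)] at h2

/-- The product of `T_N(B_N)` as a bilinear map. -/
def concatₗ : B.T →ₗ[ℝ] B.T →ₗ[ℝ] B.T :=
  LinearMap.mk₂ ℝ B.concat
    (fun u u' v => Finsupp.sum_add_index' (fun w => by simp)
      (fun w a a' => by
        rw [← Finsupp.sum_add]
        refine Finsupp.sum_congr fun w' _ => ?_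
        split_ifs <;> simp [add_mul]))
    (fun c u v => by
      rw [concat, Finsupp.sum_smul_index (fun w => by simp), concat, Finsupp.smul_sum]
      refine Finsupp.sum_congr fun w _ => ?_
      rw [Finsupp.smul_sum]
      refine Finsupp.sum_congr fun w' _ => ?_
      split_ifs
      · rw [Finsupp.smul_single, smul_eq_mul, mul_assoc]
      · rw [smul_zero])
    (fun u v v' => by
      rw [concat, concat, concat, ← Finsupp.sum_add]
      refine Finsupp.sum_congr fun w _ => ?_
      refine Finsupp.sum_add_index' (fun w => by simp) (fun w' a a' => ?_)
      split_ifs <;> simp [mul_add])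
    (fun c u v => by
      rw [concat, concat, Finsupp.smul_sum]
      refine Finsupp.sum_congr fun w _ => ?_
      rw [Finsupp.sum_smul_index (fun w => by simp), Finsupp.smul_sum]
      refine Finsupp.sum_congr fun w' _ => ?_
      split_ifs
      · rw [Finsupp.smul_single, smul_eq_mul, mul_left_comm]
      · rw [smul_zero])

theorem concatₗ_apply (u v : B.T) : B.concatₗ u v = B.concat u v := rfl

theorem concat_single (v w : B.Word) : B.concat (Finsupp.single v 1) (Finsupp.single w 1) =
    if h : wordDeg B.deg (v.1 ++ w.1) ≤ N then Finsupp.single ⟨v.1 ++ w.1, h⟩ 1 else 0 := by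
  rw [concat, Finsupp.sum_single_index (by simp), Finsupp.sum_single_index (by simp), one_mul]

/-- `Ψ` is multiplicative; both products vanish on words of total degree larger than `N`. -/
theorem Psi_conv (x y : Dual d N) : B.Psi (conv x y) = B.concat (B.Psi x) (B.Psi y) := by
  suffices (convₗ d N).compr₂ B.Psi.toLinearMap =
      B.concatₗ.compl₁₂ B.Psi.toLinearMap B.Psi.toLinearMap from
    LinearMap.congr_fun₂ this x y
  refine B.basis.ext fun v => B.basis.ext fun w => ?_
  rw [LinearMap.compr₂_apply, LinearMap.compl₁₂_apply, convₗ_apply, concatₗ_apply]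
  have h : ∀ w, B.Psi (B.basis w) = Finsupp.single w 1 := B.basis.repr_self
  rw [LinearEquiv.coe_coe, h, h, concat_single, basis_apply, basis_apply, ← res_cv, extWord,
    extWord, ← word_append]
  exact B.Psi_res_extWord _

end TreeAlphabet

/-! ### The adjoint of a renormalisation map -/

theorem adjoint_apply (M : HN d N →ₗ[ℝ] HN d N) (x : Dual d N) (h : HN d N) :
    adjoint M x h = x (M h) := rfl

namespace IsRenormalisation

variable {γ : ℝ} {M : HN d N →ₗ[ℝ] HN d N}

theorem adjoint_conv (hM : IsRenormalisation γ M) (x y : Dual d N) :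
    adjoint M (conv x y) = conv (adjoint M x) (adjoint M y) := by
  change (LinearMap.mul' ℝ ℝ ∘ₗ TensorProduct.map x y ∘ₗ coprodN d N) ∘ₗ M =
    LinearMap.mul' ℝ ℝ ∘ₗ TensorProduct.map (x ∘ₗ M) (y ∘ₗ M) ∘ₗ coprodN d N
  rw [TensorProduct.map_comp, LinearMap.comp_assoc, LinearMap.comp_assoc, LinearMap.comp_assoc,
    hM.cointeraction]

theorem eps_tree (hM : IsRenormalisation γ M) {τ : DTree d} (hτ : τ.size ≤ N) :
    eps (M ⟨MvPolynomial.X τ, tree_mem_HN hτ⟩ : H d) = 0 := by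
  refine Submodule.span_induction (p := fun h _ => eps h = 0) ?_ (map_zero _)
    (fun x y _ _ hx hy => by rw [map_add, hx, hy, add_zero])
    (fun c x _ hx => by rw [map_smul, hx, smul_zero]) (hM.tree τ hτ)
  rintro _ ⟨σ, -, rfl⟩
  exact eps_X σ

theorem adjoint_counit (hM : IsRenormalisation γ M) : adjoint M (counit d N) = counit d N := by
  suffices ext (adjoint M (counit d N)) = ext (counit d N) by
    simpa only [res_ext] using congrArg (res N) this
  refine ext_mono fun F => ?_
  by_cases hF : F.size ≤ N
  · have hF' : ∀ G : Forest d, G.size ≤ N → G.mono ∈ HN d N := fun G hG =>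
      monomial_mem_HN (by simpa using hG)
    rw [ext_apply, ext_apply, trunc_of_mem (hF' F hF), adjoint_apply]
    change eps (M _ : H d) = eps F.mono
    cases F using Forest.induction with
    | nil =>
      change eps (M ⟨1, one_mem_HN d N⟩ : H d) = _
      rw [hM.map_one, mono_nil]
    | cons i F G _ _ =>
      rw [size_cons] at hF
      have hτ : DTree.size (i, F) ≤ N := by rw [DTree.size]; dsimp only; omega
      rw [hM.map_mul ⟨_, tree_mem_HN hτ⟩ ⟨_, hF' G (by omega)⟩ _ (mono_cons i F G), eps_mul,
        hM.eps_tree hτ, eps_mono_cons, zero_mul]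
  · have : trunc d N F.mono = 0 := Subtype.ext (by
      rw [mono, trunc_monomial, if_neg (by simpa using hF)]; rfl)
    rw [ext_apply, ext_apply, this, map_zero, map_zero]

theorem tilde_eq (hM : IsRenormalisation γ M) (B : TreeAlphabet d N) (x : Dual d N) :
    B.tilde M (B.Psi x) = B.Psi (adjoint M x) := by
  suffices B.tilde M ∘ₗ B.Psi.toLinearMap = B.Psi.toLinearMap ∘ₗ adjoint M from
    LinearMap.congr_fun this x
  refine B.basis.ext fun w => ?_
  have h : B.Psi (B.basis w) = Finsupp.single w 1 := B.basis.repr_self w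
  rw [LinearMap.comp_apply, LinearMap.comp_apply, LinearEquiv.coe_coe, h, TreeAlphabet.tilde,
    Finsupp.linearCombination_single, one_smul, B.basis_apply, B.res_extWord]
  induction w.1 with
  | nil => rw [List.foldr_nil, List.foldr_nil, hM.adjoint_counit, B.Psi_counit]
  | cons i w ih => rw [List.foldr_cons, List.foldr_cons, hM.adjoint_conv, B.Psi_conv, ih]

end IsRenormalisation

/-! ### Bounds for branched rough paths -/

theorem weight_add (γ : ℝ) (n n' k k' : ℕ) :
    weight γ (n + n') (k + k') = weight γ n k + weight γ n' k' := by
  simp only [weight]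
  push_cast
  ring

theorem weight_nonneg {γ : ℝ} (hγ0 : 0 ≤ γ) (hγ1 : γ ≤ 1) (n k : ℕ) : 0 ≤ weight γ n k := by
  have := sub_nonneg.2 hγ1
  unfold weight
  positivity

theorem abs_sub_mem (s t : unitInterval) : 0 ≤ |(t : ℝ) - s| ∧ |(t : ℝ) - s| ≤ 1 :=
  ⟨abs_nonneg _, abs_sub_le_iff.2 ⟨by linarith [t.2.2, s.2.1], by linarith [s.2.2, t.2.1]⟩⟩

section

variable {γ : ℝ} {X : unitInterval → unitInterval → Dual d N}

theorem IsBRP.bound_mono (hX : IsBRP γ X) (hγ0 : 0 ≤ γ) (hγ1 : γ ≤ 1) (F : Forest d)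
    (hF : F.size ≤ N) : ∃ C : ℝ, ∀ s t : unitInterval, |ext (X s t) F.mono| ≤
      C * |(t : ℝ) - s| ^ weight γ F.size F.zeros := by
  have hmem : ∀ G : Forest d, G.size ≤ N → G.mono ∈ HN d N := fun G hG =>
    monomial_mem_HN (by simpa using hG)
  induction F using Forest.induction with
  | nil =>
    refine ⟨1, fun s t => ?_⟩
    have h1 : ext (X s t) Forest.nil.mono = 1 := by
      rw [ext_apply, trunc_of_mem (hmem _ hF)]
      exact (hX.character s t).1
    rw [h1, size_nil, zeros_nil]
    simp [weight]
  | cons i F G _ ih =>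
    rw [size_cons] at hF
    have hτ : DTree.size (i, F) ≤ N := by rw [DTree.size]; dsimp only; omega
    obtain ⟨C, hC⟩ := hX.bound (i, F) hτ
    obtain ⟨C', hC'⟩ := ih (by omega)
    refine ⟨C * C', fun s t => ?_⟩
    have h1 : ext (X s t) (cons i F G).mono = X s t ⟨_, tree_mem_HN hτ⟩ * ext (X s t) G.mono := by
      rw [ext_apply, ext_apply, trunc_of_mem (hmem _ (by rw [size_cons]; omega)),
        trunc_of_mem (hmem G (by omega))]
      exact (hX.character s t).2 _ _ _ (mono_cons i F G)
    have h2 : weight γ (cons i F G).size (cons i F G).zeros =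
        weight γ (DTree.size (i, F)) (DTree.zeros (i, F)) + weight γ G.size G.zeros := by
      rw [size_cons, zeros_cons, ← weight_add]
      rfl
    rw [h1, h2, abs_mul, Real.rpow_add_of_nonneg (abs_nonneg _) (weight_nonneg hγ0 hγ1 _ _)
      (weight_nonneg hγ0 hγ1 _ _), mul_mul_mul_comm]
    exact mul_le_mul (hC s t) (hC' s t) (abs_nonneg _) ((abs_nonneg _).trans (hC s t))

/-- The branched rough path estimate at a homogeneous element of `H_N`. -/
theorem IsBRP.bound_of_homogeneous (hX : IsBRP γ X) (hγ0 : 0 ≤ γ) (hγ1 : γ ≤ 1) (h : HN d N)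
    {n k : ℕ} (hh : ∀ m, coeff m (h : H d) ≠ 0 → monoSize m = n ∧ monoZeros m = k) :
    ∃ C : ℝ, ∀ s t : unitInterval, |X s t h| ≤ C * |(t : ℝ) - s| ^ weight γ n k := by
  have hb : ∀ m ∈ (h : H d).support, ∃ C : ℝ, ∀ s t : unitInterval,
      |ext (X s t) (monomial m (coeff m (h : H d)))| ≤ C * |(t : ℝ) - s| ^ weight γ n k := by
    intro m hm
    rw [mem_support_iff] at hm
    obtain ⟨h1, h2⟩ := hh m hm
    have h3 := mem_HN_iff.1 h.2 m hm
    obtain ⟨F, rfl⟩ := expo_surjective m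
    rw [monoSize_expo] at h1 h3
    rw [monoZeros_expo] at h2
    obtain ⟨C, hC⟩ := hX.bound_mono hγ0 hγ1 F h3
    refine ⟨|coeff F.expo (h : H d)| * C, fun s t => ?_⟩
    have h4 : (monomial F.expo (coeff F.expo (h : H d)) : H d) =
        coeff F.expo (h : H d) • F.mono := by
      rw [mono, smul_monomial, smul_eq_mul, mul_one]
    rw [h4, map_smul, smul_eq_mul, abs_mul, mul_assoc, ← h1, ← h2]
    exact mul_le_mul_of_nonneg_left (hC s t) (abs_nonneg _)
  choose! C hC using hb
  refine ⟨∑ m ∈ (h : H d).support, C m, fun s t => ?_⟩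
  have h1 : X s t h = ∑ m ∈ (h : H d).support, ext (X s t) (monomial m (coeff m (h : H d))) := by
    rw [← map_sum, ← (h : H d).as_sum, ext_apply, trunc_coe]
  rw [h1, Finset.sum_mul]
  exact (Finset.abs_sum_le_sum_abs _ _).trans (Finset.sum_le_sum fun m hm => hC m hm s t)

theorem IsBRP.adjoint (hX : IsBRP γ X) (hγ0 : 0 ≤ γ) (hγ1 : γ ≤ 1) {M : HN d N →ₗ[ℝ] HN d N}
    (hM : IsRenormalisation γ M) : IsBRP γ (fun s t => adjoint M (X s t)) where
  character s t := by
    refine ⟨?_, fun a b c habc => ?_⟩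
    · rw [adjoint_apply, hM.map_one]
      exact (hX.character s t).1
    · exact (hX.character s t).2 _ _ _ (hM.map_mul a b c habc)
  diag t := by rw [hX.diag, hM.adjoint_counit]
  chen s u t := by rw [← hM.adjoint_conv, hX.chen]
  bound τ hτ := by
    have key : ∃ C : ℝ, ∀ s t : unitInterval,
        |ext (X s t) (M ⟨MvPolynomial.X τ, tree_mem_HN hτ⟩ : H d)| ≤
          C * |(t : ℝ) - s| ^ weight γ τ.size τ.zeros := by
      refine Submodule.span_induction (p := fun h _ => ∃ C : ℝ, ∀ s t : unitInterval,
        |ext (X s t) h| ≤ C * |(t : ℝ) - s| ^ weight γ τ.size τ.zeros) ?_ ⟨0, by simp⟩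
        (fun x y _ _ hx hy => ?_) (fun c x _ hx => ?_) (hM.tree τ hτ)
      · rintro _ ⟨σ, ⟨hw, hσ⟩, rfl⟩
        obtain ⟨C, hC⟩ := hX.bound σ (hσ.trans hτ)
        refine ⟨|C|, fun s t => ?_⟩
        rw [ext_apply, trunc_of_mem (tree_mem_HN (hσ.trans hτ))]
        refine (hC s t).trans (mul_le_mul (le_abs_self C) ?_
          (Real.rpow_nonneg (abs_nonneg _) _) (abs_nonneg C))
        exact Real.rpow_le_rpow_of_exponent_ge' (abs_sub_mem s t).1 (abs_sub_mem s t).2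
          (weight_nonneg hγ0 hγ1 _ _) hw
      · obtain ⟨C, hC⟩ := hx
        obtain ⟨C', hC'⟩ := hy
        refine ⟨C + C', fun s t => ?_⟩
        rw [map_add, add_mul]
        exact (abs_add_le _ _).trans (add_le_add (hC s t) (hC' s t))
      · obtain ⟨C, hC⟩ := hx
        refine ⟨|c| * C, fun s t => ?_⟩
        rw [map_smul, smul_eq_mul, abs_mul, mul_assoc]
        exact mul_le_mul_of_nonneg_left (hC s t) (abs_nonneg _)
    simpa only [ext_apply, trunc_coe, adjoint_apply] using key

end

/-! ### Shuffles -/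

/-- The ways to split a word into two complementary subwords, listed with multiplicity. -/
def unshuffle {α : Type*} : List α → List (List α × List α)
  | [] => [([], [])]
  | i :: w => (unshuffle w).map (fun p => (i :: p.1, p.2)) ++
      (unshuffle w).map (fun p => (p.1, i :: p.2))

/-- Splitting words is dual to shuffling them. -/
theorem sum_unshuffle_eq_sum_shuffle {α : Type} [DecidableEq α] (w u v : List α) :
    ((unshuffle w).map fun p =>
      (if p.1 = u then (1 : ℝ) else 0) * (if p.2 = v then 1 else 0)).sum =
    ((shuffle u v).map fun s => if w = s then (1 : ℝ) else 0).sum := by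
  induction w generalizing u v with
  | nil =>
    cases u with
    | nil => cases v <;> simp [unshuffle, shuffle]
    | cons a u => cases v <;> simp [unshuffle, shuffle, Function.comp_def]
  | cons i w ih =>
    simp only [unshuffle, List.map_append, List.map_map, List.sum_append, Function.comp_def]
    have hl : ∀ u v : List α, ((unshuffle w).map fun p => (if i :: p.1 = u then (1 : ℝ) else 0) *
        (if p.2 = v then 1 else 0)).sum = match u with
        | [] => 0
        | a :: u' => if i = a then ((shuffle u' v).map fun s => if w = s then (1 : ℝ) else 0).sum
          else 0 := by
      intro u v
      cases u with
      | nil => simp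
      | cons a u' =>
        by_cases h : i = a
        · subst h
          simp only [List.cons.injEq, true_and, if_true, ← ih]
        · simp [h]
    have hr : ∀ u v : List α, ((unshuffle w).map fun p => (if p.1 = u then (1 : ℝ) else 0) *
        (if i :: p.2 = v then 1 else 0)).sum = match v with
        | [] => 0
        | b :: v' => if i = b then ((shuffle u v').map fun s => if w = s then (1 : ℝ) else 0).sum
          else 0 := by
      intro u v
      cases v with
      | nil => simp
      | cons b v' =>
        by_cases h : i = b
        · subst h
          simp only [List.cons.injEq, true_and, if_true, ← ih]
        · simp [h]
    have hs : ∀ (a : α) (L : List (List α)), ((L.map (List.cons a)).map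
        fun s => if i :: w = s then (1 : ℝ) else 0).sum =
        if i = a then (L.map fun s => if w = s then (1 : ℝ) else 0).sum else 0 := by
      intro a L
      by_cases h : i = a
      · subst h
        simp [Function.comp_def]
      · simp [h, Function.comp_def]
    rw [hl, hr]
    cases u with
    | nil =>
      cases v with
      | nil => simp [shuffle]
      | cons b v =>
        have := hs b [v]
        simp only [List.map_cons, List.map_nil] at this
        simp only [shuffle, List.map_cons, List.map_nil, zero_add, this]
    | cons a u =>
      cases v with
      | nil =>
        have := hs a [u]
        have h0 : shuffle u [] = [u] := by cases u <;> simp [shuffle]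
        simp only [List.map_cons, List.map_nil] at this
        simp only [shuffle, h0, List.map_cons, List.map_nil, add_zero, this]
      | cons b v =>
        dsimp only
        rw [shuffle, List.map_append, List.sum_append, hs, hs]

/-- The product with a primitive functional `x`, evaluated at a product in `H ⊗ H`. -/
theorem pair_mul {x y : Module.Dual ℝ (H d)} {ι : Type*} {L : List ι}
    {f g : ι → Module.Dual ℝ (H d)} (hx : ∀ a b, x (a * b) = x a * eps b + eps a * x b)
    (hy : ∀ a b, y (a * b) = (L.map fun k => f k a * g k b).sum) (z w : H d ⊗[ℝ] H d) :
    pair x y (z * w) = (L.map fun k => pair x (f k) z * pair eps (g k) w).sum +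
      (L.map fun k => pair eps (f k) z * pair x (g k) w).sum := by
  induction z with
  | zero => simp
  | add z z' hz hz' =>
    simp only [add_mul, map_add, hz, hz', List.sum_map_add]
    ring
  | tmul a a' =>
    induction w with
    | zero => simp
    | add w w' hw hw' =>
      simp only [mul_add, map_add, hw, hw', List.sum_map_add]
      ring
    | tmul b b' =>
      simp only [Algebra.TensorProduct.tmul_mul_tmul, pair_tmul, hx, hy]
      rw [add_mul, ← List.sum_map_mul_left, ← List.sum_map_mul_left]
      congr 3 <;> funext k <;> ring

theorem word_mul {ι : Type*} {e : ι → Module.Dual ℝ (H d)}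
    (he : ∀ i a b, e i (a * b) = e i a * eps b + eps a * e i b) (w : List ι) (a b : H d) :
    word e w (a * b) = ((unshuffle w).map fun p => word e p.1 a * word e p.2 b).sum := by
  induction w generalizing a b with
  | nil => simp [unshuffle, word_nil, ← constantCoeff_eq]
  | cons i w ih =>
    rw [word_cons, cv_apply, map_mul, pair_mul (he i) ih, unshuffle, List.map_append,
      List.sum_append, List.map_map, List.map_map]
    simp only [← cv_apply, eps_cv, Function.comp_def, word_cons]

/-! ### The dual basis of the basis of words -/

instance : FiniteDimensional ℝ (HN d N) := by
  have h : HN d N = Submodule.span ℝ ((fun m => monomial m 1) '' {m | monoSize m ≤ N}) :=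
    restrictSupport_eq_span ..
  rw [h]
  exact FiniteDimensional.span_of_finite ℝ ((finite_monoSize_le d N).image _)

namespace TreeAlphabet

variable (B : TreeAlphabet d N)

theorem exists_dualElement (w : List (Fin B.card)) :
    ∃ h : HN d N, ∀ x : Dual d N, B.coeff (B.Psi x) w = x h := by
  by_cases hw : wordDeg B.deg w ≤ N
  · obtain ⟨h, hh⟩ := (Module.evalEquiv ℝ (HN d N)).surjective
      (Finsupp.lapply (⟨w, hw⟩ : B.Word) ∘ₗ B.Psi.toLinearMap)
    refine ⟨h, fun x => ?_⟩
    rw [coeff, dif_pos hw]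
    exact (LinearMap.congr_fun hh x).symm
  · exact ⟨0, fun x => by rw [coeff, dif_neg hw, map_zero]⟩

/-- The elements of `H_N` that form the dual basis of the basis of words: the coefficient of a word
in `Ψ x` is the value of `x` there. They are zero for words of degree larger than `N`. -/
def dualElement (w : List (Fin B.card)) : HN d N := (B.exists_dualElement w).choose

theorem coeff_Psi (x : Dual d N) (w : List (Fin B.card)) :
    B.coeff (B.Psi x) w = x (B.dualElement w) := (B.exists_dualElement w).choose_spec x

theorem eq_of_basis {h h' : HN d N} (hh : ∀ w, B.basis w h = B.basis w h') : h = h' := by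
  have h1 : Module.Dual.eval ℝ (HN d N) h = Module.Dual.eval ℝ (HN d N) h' := B.basis.ext hh
  exact (Module.evalEquiv ℝ (HN d N)).injective h1

theorem extWord_dualElement (v w : List (Fin B.card)) (hw : wordDeg B.deg w ≤ N) :
    B.extWord v (B.dualElement w) = if v = w then 1 else 0 := by
  have h1 := B.coeff_Psi (res N (B.extWord v)) w
  rw [res_apply] at h1
  rw [← h1, coeff, dif_pos hw, Psi_res_extWord]
  split_ifs with h2 h3 h3
  · subst h3
    exact Finsupp.single_eq_same
  · exact Finsupp.single_eq_of_ne fun h => h3 (congrArg Subtype.val h).symm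
  · exact absurd (h3 ▸ hw) h2
  · rfl

theorem basis_dualElement (v : B.Word) (w : List (Fin B.card)) :
    B.basis v (B.dualElement w) = if v.1 = w then 1 else 0 := by
  by_cases hw : wordDeg B.deg w ≤ N
  · rw [basis_apply, res_apply, extWord_dualElement _ _ _ hw]
  · have h1 := B.coeff_Psi (B.basis v) w
    rw [coeff, dif_neg hw] at h1
    rw [← h1, if_neg]
    rintro rfl
    exact hw v.2

theorem scale_dualElement (a b : ℝ) (w : List (Fin B.card)) :
    scale d a b (B.dualElement w) =
      (a ^ wordDeg B.deg w * b ^ B.wordZeros w) • (B.dualElement w : H d) := by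
  have hmem : scale d a b (B.dualElement w) ∈ HN d N := mem_HN_iff.2 fun m hm => by
    rw [coeff_scale] at hm
    exact mem_HN_iff.1 (B.dualElement w).2 m (right_ne_zero_of_mul hm)
  refine congrArg Subtype.val (B.eq_of_basis (h := ⟨_, hmem⟩)
    (h' := (a ^ wordDeg B.deg w * b ^ B.wordZeros w) • B.dualElement w) fun v => ?_)
  have h1 := LinearMap.congr_fun (B.extWord_comp_scale a b v.1) (B.dualElement w : H d)
  have h2 := B.basis_dualElement v w
  rw [map_smul, h2]
  rw [basis_apply, res_apply] at h2 ⊢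
  refine h1.trans ?_
  rw [LinearMap.smul_apply, h2]
  split_ifs with h
  · rw [h]
  · rw [smul_zero, smul_zero]

theorem dualElement_homogeneous (w : List (Fin B.card)) (m : DTree d →₀ ℕ)
    (hm : MvPolynomial.coeff m (B.dualElement w : H d) ≠ 0) :
    monoSize m = wordDeg B.deg w ∧ monoZeros m = B.wordZeros w := by
  constructor <;> by_contra h
  · exact hm (coeff_eq_zero_of_scale_two (by rw [scale_dualElement, one_pow, mul_one]) h)
  · exact hm (coeff_eq_zero_of_scale_zeros (by rw [scale_dualElement, one_pow, one_mul]) h)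

theorem dualElement_nil : B.dualElement [] = ⟨1, one_mem_HN d N⟩ := by
  refine B.eq_of_basis fun v => ?_
  rw [basis_dualElement, basis_apply, res_apply]
  cases v.1 with
  | nil => exact eps_one.symm
  | cons i w =>
    have h1 := B.extLetter_mul i 1 1
    have h2 : B.extLetter i 1 = 0 := by
      rw [mul_one, eps_one] at h1
      linarith
    change _ = cv (B.extLetter i) (B.extWord w) 1
    rw [cv_apply, map_one, Algebra.TensorProduct.one_def, pair_tmul, h2, zero_mul,
      if_neg (List.cons_ne_nil i w)]

/-- The dual basis multiplies by shuffling, as the letters are primitive. -/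
theorem dualElement_mul (u v : List (Fin B.card)) (huv : wordDeg B.deg u + wordDeg B.deg v ≤ N) :
    ((((shuffle u v).map B.dualElement).sum : HN d N) : H d) =
      (B.dualElement u : H d) * (B.dualElement v : H d) := by
  have hmem : (B.dualElement u : H d) * (B.dualElement v : H d) ∈ HN d N := by
    refine mem_HN_of_scale_two ?_ huv
    rw [map_mul, scale_dualElement, scale_dualElement, smul_mul_smul_comm, one_pow, one_pow,
      mul_one, mul_one, pow_add]
  refine congrArg Subtype.val (B.eq_of_basis (h' := ⟨_, hmem⟩) fun w => ?_)
  rw [map_list_sum, List.map_map]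
  have h1 : (B.basis w) ∘ B.dualElement = fun s => if w.1 = s then (1 : ℝ) else 0 :=
    funext fun s => B.basis_dualElement w s
  rw [h1, ← sum_unshuffle_eq_sum_shuffle, basis_apply, res_apply]
  change _ = B.extWord w.1 (_ * _)
  have hmul : ∀ a b, B.extWord w.1 (a * b) =
      ((unshuffle w.1).map fun p => B.extWord p.1 a * B.extWord p.2 b).sum :=
    word_mul B.extLetter_mul w.1
  rw [hmul]
  simp only [B.extWord_dualElement _ u (by omega), B.extWord_dualElement _ v (by omega)]

theorem sum_weight (γ : ℝ) (w : List (Fin B.card)) :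
    (w.map fun i => weight γ (B.deg i) (B.zeros i)).sum =
      weight γ (wordDeg B.deg w) (B.wordZeros w) := by
  induction w with
  | nil => simp [weight, wordDeg, wordZeros]
  | cons i w ih =>
    rw [List.map_cons, List.sum_cons, ih, ← weight_add]
    simp [wordDeg, wordZeros]

/-- The image of a branched rough path under `Ψ` is an anisotropic rough path. -/
theorem isARP_Psi {γ : ℝ} {X : unitInterval → unitInterval → Dual d N} (hX : IsBRP γ X)
    (hγ0 : 0 ≤ γ) (hγ1 : γ ≤ 1) : B.IsARP γ (fun s t => B.Psi (X s t)) where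
  character s t := by
    refine ⟨?_, fun u v huv => ?_⟩
    · rw [coeff_Psi, dualElement_nil]
      exact (hX.character s t).1
    · rw [coeff_Psi, coeff_Psi, ← (hX.character s t).2 _ _ _ (B.dualElement_mul u v huv),
        map_list_sum, List.map_map]
      exact congrArg List.sum (List.map_congr_left fun w _ => B.coeff_Psi _ w)
  diag t := by rw [hX.diag, Psi_counit]
  chen s u t := by rw [← Psi_conv, hX.chen]
  bound w _ := by
    simp only [coeff_Psi, sum_weight]
    exact hX.bound_of_homogeneous hγ0 hγ1 _ (B.dualElement_homogeneous w)

end TreeAlphabet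

end

end RoughTrees

theorem theorem4p6 (d : ℕ) (γ : ℝ) (hγ0 : 0 < γ) (hγ1 : γ < 1)
    (N : ℕ) (hN : IsGreatest {n : ℕ | γ * (n : ℝ) ≤ 1} N) :
    Nonempty (RoughTrees.TreeAlphabet d N) ∧
    ∀ (B : RoughTrees.TreeAlphabet d N)
      (M : RoughTrees.HN d N →ₗ[ℝ] RoughTrees.HN d N),
      RoughTrees.IsRenormalisation γ M →
      (∀ u v : B.T, B.tilde M (B.concat u v) = B.concat (B.tilde M u) (B.tilde M v)) ∧
      (∀ i, B.tilde M (B.single i) = B.Psi (RoughTrees.adjoint M (B.letter i))) ∧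
      ∀ X : unitInterval → unitInterval → RoughTrees.Dual d N, RoughTrees.IsBRP γ X →
        RoughTrees.IsBRP γ (fun s t => RoughTrees.adjoint M (X s t)) ∧
        B.IsARP γ (fun s t => B.Psi (X s t)) ∧
        B.IsARP γ (fun s t => B.tilde M (B.Psi (X s t))) ∧
        ∀ s t, B.Psi (RoughTrees.adjoint M (X s t)) = B.tilde M (B.Psi (X s t)) := by
  refine ⟨RoughTrees.nonempty_treeAlphabet d N, fun B M hM => ⟨fun u v => ?_, fun i => ?_,
    fun X hX => ?_⟩⟩
  · obtain ⟨x, rfl⟩ := B.Psi.surjective u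
    obtain ⟨y, rfl⟩ := B.Psi.surjective v
    rw [← B.Psi_conv, hM.tilde_eq, hM.tilde_eq, hM.tilde_eq, hM.adjoint_conv, B.Psi_conv]
  · rw [← B.Psi_letter, hM.tilde_eq]
  · have hMX := hX.adjoint hγ0.le hγ1.le hM
    refine ⟨hMX, B.isARP_Psi hX hγ0.le hγ1.le, ?_, fun s t => (hM.tilde_eq B _).symm⟩
    simp only [hM.tilde_eq]
    exact B.isARP_Psi hMX hγ0.le hγ1.le
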